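/- **Theorem 1.** Let $(M,J)$ be a complex manifold of complex dimension $n$ and let $g$ be an indefinite locally conformal Kähler (l.c.K.) metric on $M$ of index $2s$, $0<s<n$: $g$ is a smooth $J$-invariant semi-Riemannian metric of index $2s$, and every point of $M$ has an open neighbourhood $U$ with a $C^\infty$ function $f:U\to\mathbb R$ such that $e^{-f}g$ is an indefinite Kähler metric on $U$ (i.e. $J$ is parallel for its Levi-Civita connection). Let $\omega$ be the Lee form (the global $1$-form with $\omega=df$ on such sets $U$) and $B$ the Lee field, $g(X,B)=\omega(X)$. Assume that $\omega$ is parallel, $\nabla\omega=0$ for the Levi-Civita connection $\nabla$ of $g$, and that $B$ vanishes nowhere. Let $\mathcal F$ be the foliation of $M$ defined by the Pfaff equation $\omega=0$; its leaves are the maximal connected (injectively immersed) integral manifolds of $\ker\omega$. Then $c=g(B,B)$ is locally constant on $M$ (so it is a constant if $M$ is connected, and it is constant along each leaf), and for each leaf $L$ of $\mathcal F$: i) if $c\neq 0$ on $L$, then $L$ is a semi-Riemannian hypersurface of $(M,g)$ (the induced metric is nondegenerate), of index $2s$ if $c>0$ and of index $2s-1$ if $c<0$, and $L$ is totally geodesic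 with respect to the decomposition $TM|_L=TL\oplus TL^\perp$; ii) if $c=0$ on $L$, then $L$ is a lightlike hypersurface of $(M,g)$ (the radical $T_xL\cap T_xL^\perp$ is one-dimensional at every $x\in L$), and $L$ is totally geodesic in the following sense. Let $S$ be any screen distribution on $L$, i.e. a smooth distribution with $TL=S\oplus TL^\perp$, let $E$ be any smooth vector subbundle with $S^\perp=TL^\perp\oplus E$, and let $\mathrm{tr}(TL)$ be the lightlike transversal bundle with fibres $$\mathrm{tr}(TL)_x=\mathbb R\,N_V,\qquad N_V=\frac1{\omega(V)}\Big\{V-\frac{g(V,V)}{2\,\omega(V)}\,B_x\Big\},\qquad 0\neq V\in E_x .$$ Then $L$ is totally geodesic with respect to the decomposition $TM|_L=TL\oplus\mathrm{tr}(TL)$. Here, for a bundle $T\to L$ with $TM|_L=TL\oplus T$ and associated projections $\tan$ and $\mathrm{tra}$ (onto $TL$ and $T$), $L$ is called totally geodesic if the second fundamental form $h(X,Y)=\mathrm{tra}(\nabla_XY)$ vanishes for all $X,Y$ tangent to $L$ and every geodesic in $L$ of the induced connection $\nabla^L_XY=\tan(\nabla_XY)$ is a geodesic of $(M,g)$; that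 the sum $TM|_L=TL\oplus T$ is direct is part of the assertion. -/

import Mathlib

open scoped Manifold ContDiff
open Bundle

noncomputable section

section RealManifolds

variable {E : Type*} [NormedAddCommGroup E] [NormedSpace ℝ E]
  {M : Type*} [TopologicalSpace M] [ChartedSpace E M]
  {F : Type*} [NormedAddCommGroup F] [NormedSpace ℝ F]
  {N : Type*} [TopologicalSpace N] [ChartedSpace F N]

/-! ### Tensor fields and semi-Riemannian metrics -/

variable (E M) in
/-- Fields of bilinear forms on the tangent spaces of `M` (no smoothness, no symmetry). -/
abbrev BilinField : Type _ :=
  ∀ x : M, TangentSpace 𝓘(ℝ, E) x →L[ℝ] TangentSpace 𝓘(ℝ, E) x →L[ℝ] ℝ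

variable (E M) in
/-- Fields of linear forms on the tangent spaces of `M` (no smoothness). -/
abbrev OneFormField : Type _ := ∀ x : M, TangentSpace 𝓘(ℝ, E) x →L[ℝ] ℝ

/-- `g` is a smooth semi-Riemannian metric (symmetric, nondegenerate) on the set `U`. -/
structure IsSemiRiemannianMetricOn [IsManifold 𝓘(ℝ, E) ∞ M] (g : BilinField E M) (U : Set M) :
    Prop where
  smooth : ContMDiffOn 𝓘(ℝ, E) (𝓘(ℝ, E).prod 𝓘(ℝ, E →L[ℝ] E →L[ℝ] ℝ)) ∞
    (fun x => (TotalSpace.mk' (E →L[ℝ] E →L[ℝ] ℝ) x (g x) :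
      TotalSpace (E →L[ℝ] E →L[ℝ] ℝ)
        (fun x : M => TangentSpace 𝓘(ℝ, E) x →L[ℝ] TangentSpace 𝓘(ℝ, E) x →L[ℝ] ℝ))) U
  symm : ∀ x ∈ U, ∀ u v : TangentSpace 𝓘(ℝ, E) x, g x u v = g x v u
  nondegenerate : ∀ x ∈ U, ∀ u : TangentSpace 𝓘(ℝ, E) x, (∀ v, g x u v = 0) → u = 0

/-- The index of the bilinear form `g x`: the largest dimension of a subspace of the tangent
space on which it is negative definite. -/
def tangentIndex (g : BilinField E M) (x : M) : ℕ :=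
  sigNeg
    (LinearMap.BilinMap.toQuadraticMap
      ((ContinuousLinearMap.coeLM ℝ).comp (g x).toLinearMap :
        LinearMap.BilinForm ℝ (TangentSpace 𝓘(ℝ, E) x)))

/-- The linear form field `θ` is a smooth 1-form. -/
def IsSmoothOneForm [IsManifold 𝓘(ℝ, E) ∞ M] (θ : OneFormField E M) : Prop :=
  ContMDiff 𝓘(ℝ, E) (𝓘(ℝ, E).prod 𝓘(ℝ, E →L[ℝ] ℝ)) ∞
    (fun x => (TotalSpace.mk' (E →L[ℝ] ℝ) x (θ x) :
      TotalSpace (E →L[ℝ] ℝ) (fun x : M => TangentSpace 𝓘(ℝ, E) x →L[ℝ] ℝ)))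

/-- The pullback `φ^* g` of a field of bilinear forms. -/
def pullbackBilin (φ : N → M) (g : BilinField E M) : BilinField F N := fun y =>
  (ContinuousLinearMap.precomp ℝ (mfderiv 𝓘(ℝ, F) 𝓘(ℝ, E) φ y)).comp
    ((g (φ y)).comp (mfderiv 𝓘(ℝ, F) 𝓘(ℝ, E) φ y))

/-- The pullback `φ^* θ` of a field of linear forms. -/
def pullbackForm (φ : N → M) (θ : OneFormField E M) : OneFormField F N := fun y =>
  (θ (φ y)).comp (mfderiv 𝓘(ℝ, F) 𝓘(ℝ, E) φ y)

/-! ### The Levi-Civita connection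

Everything at a point `x` is written in the coordinates of the preferred chart at `x`; the
tangent space at `x` is identified with `E` through the differential of that chart. -/

/-- The metric `g` in the coordinates of the preferred chart at `x`. -/
def metricInChart (g : BilinField E M) (x : M) : E → E →L[ℝ] E →L[ℝ] ℝ :=
  pullbackBilin (F := E) (N := E) (extChartAt 𝓘(ℝ, E) x).symm g

/-- The linear form field `θ` in the coordinates of the preferred chart at `x`. -/
def formInChart (θ : OneFormField E M) (x : M) : E → E →L[ℝ] ℝ :=
  pullbackForm (F := E) (N := E) (extChartAt 𝓘(ℝ, E) x).symm θ

/-- A field of endomorphisms of the tangent spaces in the coordinates of the preferred chart at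
`x`. -/
def endInChart (A : ∀ x : M, TangentSpace 𝓘(ℝ, E) x →L[ℝ] TangentSpace 𝓘(ℝ, E) x) (x : M)
    (y : E) : E →L[ℝ] E :=
  (mfderiv 𝓘(ℝ, E) 𝓘(ℝ, E) (extChartAt 𝓘(ℝ, E) x) ((extChartAt 𝓘(ℝ, E) x).symm y)).comp
    ((A ((extChartAt 𝓘(ℝ, E) x).symm y)).comp
      (mfderiv 𝓘(ℝ, E) 𝓘(ℝ, E) (extChartAt 𝓘(ℝ, E) x).symm y))

/-- A vector tangent to `M` at `y` in the coordinates of the preferred chart at `x`. -/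
def vectorInChart (x y : M) (v : TangentSpace 𝓘(ℝ, E) y) : E :=
  mfderiv 𝓘(ℝ, E) 𝓘(ℝ, E) (extChartAt 𝓘(ℝ, E) x) y v

/-- The Christoffel symbols of the first kind of `g` at `x`:
`w ↦ (1/2) (∂_u g(v,w) + ∂_v g(u,w) - ∂_w g(u,v))`. -/
def christoffelFirst (g : BilinField E M) (x : M) (u v : E) : E →L[ℝ] ℝ :=
  let x₀ : E := extChartAt 𝓘(ℝ, E) x x
  (1 / 2 : ℝ) • (fderiv ℝ (fun y => metricInChart g x y v) x₀ u
    + fderiv ℝ (fun y => metricInChart g x y u) x₀ v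
    - fderiv ℝ (fun y => metricInChart g x y u v) x₀)

/-- The Christoffel symbols of `g` at `x`: `Γ(u,v)` is the vector `z` with
`g(z,w) = (1/2) (∂_u g(v,w) + ∂_v g(u,w) - ∂_w g(u,v))` for all `w`. -/
def christoffel (g : BilinField E M) (x : M) (u v : TangentSpace 𝓘(ℝ, E) x) :
    TangentSpace 𝓘(ℝ, E) x :=
  let κ : TangentSpace 𝓘(ℝ, E) x →L[ℝ] ℝ := christoffelFirst (E := E) g x u v
  (g x).inverse κ

/-- The covariant derivative `∇_X V`, with respect to the Levi-Civita connection of `g`, of a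
vector field `V` along a map `φ : N → M` in the direction of a tangent vector `X` of `N` at `p`:
in the coordinates at `φ p` it is `dV(X) + Γ(dφ(X), V)`. -/
def covDerivAlong (g : BilinField E M) (φ : N → M) (V : ∀ q : N, TangentSpace 𝓘(ℝ, E) (φ q))
    (p : N) (X : TangentSpace 𝓘(ℝ, F) p) : TangentSpace 𝓘(ℝ, E) (φ p) :=
  let dV : TangentSpace 𝓘(ℝ, E) (φ p) :=
    mfderiv 𝓘(ℝ, F) 𝓘(ℝ, E) (fun q : N => vectorInChart (φ p) (φ q) (V q)) p X
  dV + christoffel g (φ p) (mfderiv 𝓘(ℝ, F) 𝓘(ℝ, E) φ p X) (V p)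

/-- The covariant derivative `(∇_u θ)(v) = ∂_u(θ)(v) - θ(Γ(u,v))` of a 1-form. -/
def covDerivForm (g : BilinField E M) (θ : OneFormField E M) (x : M)
    (u v : TangentSpace 𝓘(ℝ, E) x) : ℝ :=
  fderiv ℝ (formInChart θ x) (extChartAt 𝓘(ℝ, E) x x) u v - θ x (christoffel g x u v)

/-- The covariant derivative `(∇_u A)(v) = ∂_u(A)(v) + Γ(u, A v) - A Γ(u,v)` of a field of
endomorphisms of the tangent spaces. -/
def covDerivEnd (g : BilinField E M)
    (A : ∀ x : M, TangentSpace 𝓘(ℝ, E) x →L[ℝ] TangentSpace 𝓘(ℝ, E) x) (x : M)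
    (u v : TangentSpace 𝓘(ℝ, E) x) : TangentSpace 𝓘(ℝ, E) x :=
  let dA : TangentSpace 𝓘(ℝ, E) x :=
    fderiv ℝ (endInChart A x) (extChartAt 𝓘(ℝ, E) x x) u v
  dA + christoffel g x u (A x v) - A x (christoffel g x u v)

/-- The smooth 1-form `θ` is parallel: `∇θ = 0`. -/
def IsParallelOneForm [IsManifold 𝓘(ℝ, E) ∞ M] (g : BilinField E M) (θ : OneFormField E M) :
    Prop :=
  IsSmoothOneForm θ ∧ ∀ (x : M) (u v : TangentSpace 𝓘(ℝ, E) x), covDerivForm g θ x u v = 0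

/-- The velocity of a curve in `M`. -/
def curveVelocity (γ : ℝ → M) (t : ℝ) : TangentSpace 𝓘(ℝ, E) (γ t) :=
  mfderiv 𝓘(ℝ, ℝ) 𝓘(ℝ, E) γ t (1 : ℝ)

/-- The acceleration `∇_{γ'} γ'` of a curve in `M`. -/
def curveAcceleration (g : BilinField E M) (γ : ℝ → M) (t : ℝ) : TangentSpace 𝓘(ℝ, E) (γ t) :=
  covDerivAlong (F := ℝ) g γ (curveVelocity γ) t (1 : ℝ)

/-- On the open set `s` of parameters, `γ` is a (smooth) geodesic of `(M, g)`. -/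
def IsGeodesicOn (g : BilinField E M) (γ : ℝ → M) (s : Set ℝ) : Prop :=
  ContMDiffOn 𝓘(ℝ, ℝ) 𝓘(ℝ, E) ∞ γ s ∧ ∀ t ∈ s, curveAcceleration g γ t = 0

/-! ### Immersed hypersurfaces -/

/-- The tangent space of the immersed manifold `i : N → M` at `p`, as a subspace of the tangent
space of `M` at `i p`. -/
def immersedTangent (E : Type*) [NormedAddCommGroup E] [NormedSpace ℝ E] {M : Type*}
    [TopologicalSpace M] [ChartedSpace E M] (F : Type*) [NormedAddCommGroup F] [NormedSpace ℝ F]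
    {N : Type*} [TopologicalSpace N] [ChartedSpace F N] (i : N → M) (p : N) :
    Submodule ℝ (TangentSpace 𝓘(ℝ, E) (i p)) :=
  LinearMap.range (mfderiv 𝓘(ℝ, F) 𝓘(ℝ, E) i p).toLinearMap

/-- The `g`-orthogonal complement of a subspace of a tangent space. -/
def tangentOrth (g : BilinField E M) (x : M) (W : Submodule ℝ (TangentSpace 𝓘(ℝ, E) x)) :
    Submodule ℝ (TangentSpace 𝓘(ℝ, E) x) where
  carrier := {u | ∀ w ∈ W, g x u w = 0}
  add_mem' := fun {a b} ha hb w hw => by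
    rw [map_add, add_apply, ha w hw, hb w hw, add_zero]
  zero_mem' := fun w _ => by rw [map_zero, zero_apply]
  smul_mem' := fun c a ha w hw => by
    rw [map_smul, smul_apply, ha w hw, smul_zero]

/-- The normal space `T_pL^⊥` of the immersed manifold `i : L → M`. -/
def immersedNormal (F : Type*) [NormedAddCommGroup F] [NormedSpace ℝ F] {N : Type*}
    [TopologicalSpace N] [ChartedSpace F N] (g : BilinField E M) (i : N → M) (p : N) :
    Submodule ℝ (TangentSpace 𝓘(ℝ, E) (i p)) :=
  tangentOrth g (i p) (immersedTangent E F i p)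

/-- `i : N → M` is a (connected or not) immersed hypersurface: an injective smooth immersion of
codimension one. -/
structure IsImmersedHypersurface (E : Type*) [NormedAddCommGroup E] [NormedSpace ℝ E] {M : Type*}
    [TopologicalSpace M] [ChartedSpace E M] (F : Type*) [NormedAddCommGroup F] [NormedSpace ℝ F]
    {N : Type*} [TopologicalSpace N] [ChartedSpace F N] (i : N → M) : Prop where
  smooth : ContMDiff 𝓘(ℝ, F) 𝓘(ℝ, E) ∞ i
  injective : Function.Injective i
  immersion : ∀ p, Function.Injective (mfderiv 𝓘(ℝ, F) 𝓘(ℝ, E) i p)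
  codim : Module.finrank ℝ E = Module.finrank ℝ F + 1

/-- `i : N → M` is a semi-Riemannian hypersurface of index `ν`: the induced metric `i^* g` is a
semi-Riemannian metric of index `ν`. -/
structure IsSemiRiemannianHypersurface (F : Type*) [NormedAddCommGroup F] [NormedSpace ℝ F]
    {N : Type*} [TopologicalSpace N] [ChartedSpace F N] [IsManifold 𝓘(ℝ, F) ∞ N]
    (g : BilinField E M) (i : N → M) (ν : ℕ) : Prop where
  hypersurface : IsImmersedHypersurface E F i
  metric : IsSemiRiemannianMetricOn (pullbackBilin (F := F) i g) Set.univ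
  index : ∀ p : N, tangentIndex (pullbackBilin (F := F) i g) p = ν

/-- `i : N → M` is a lightlike hypersurface: at each point the radical `T_pN ∩ T_pN^⊥` of the
tangent space has dimension one. -/
structure IsLightlikeHypersurface (F : Type*) [NormedAddCommGroup F] [NormedSpace ℝ F]
    {N : Type*} [TopologicalSpace N] [ChartedSpace F N] (g : BilinField E M) (i : N → M) :
    Prop where
  hypersurface : IsImmersedHypersurface E F i
  radical : ∀ p : N, Module.finrank ℝ
    (immersedTangent E F i p ⊓ immersedNormal F g i p :
      Submodule ℝ (TangentSpace 𝓘(ℝ, E) (i p))) = 1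

open Classical in
/-- The projection onto `P` along `Q`, when `P` and `Q` are complementary. -/
def projAlong {V : Type*} [AddCommGroup V] [Module ℝ V] (P Q : Submodule ℝ V) : V →ₗ[ℝ] V :=
  if h : IsCompl P Q then P.projection Q h else 0

/-- The connection induced on the immersed manifold `i : N → M` by the Levi-Civita connection of
`g` and a transversal bundle `T`, applied to a tangent vector field `Y` of `N`:
`∇^N_X Y = tan (∇_X Y)`. -/
def inducedConnection (g : BilinField E M) (i : N → M)
    (T : ∀ p : N, Submodule ℝ (TangentSpace 𝓘(ℝ, E) (i p)))
    (Y : ∀ p : N, TangentSpace 𝓘(ℝ, F) p) (p : N) (X : TangentSpace 𝓘(ℝ, F) p) :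
    TangentSpace 𝓘(ℝ, E) (i p) :=
  projAlong (immersedTangent E F i p) (T p)
    (covDerivAlong g i (fun q => mfderiv 𝓘(ℝ, F) 𝓘(ℝ, E) i q (Y q)) p X)

/-- The second fundamental form `h(X,Y) = tra (∇_X Y)` of the immersed manifold `i : N → M` with
respect to a transversal bundle `T`. -/
def secondFundamentalForm (g : BilinField E M) (i : N → M)
    (T : ∀ p : N, Submodule ℝ (TangentSpace 𝓘(ℝ, E) (i p)))
    (Y : ∀ p : N, TangentSpace 𝓘(ℝ, F) p) (p : N) (X : TangentSpace 𝓘(ℝ, F) p) :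
    TangentSpace 𝓘(ℝ, E) (i p) :=
  projAlong (T p) (immersedTangent E F i p)
    (covDerivAlong g i (fun q => mfderiv 𝓘(ℝ, F) 𝓘(ℝ, E) i q (Y q)) p X)

/-- On the open set `s` of parameters, `δ` is a (smooth) geodesic of the connection induced on the
immersed manifold `i : N → M` by `g` and the transversal bundle `T`. -/
def IsInducedGeodesicOn (F : Type*) [NormedAddCommGroup F] [NormedSpace ℝ F]
    {N : Type*} [TopologicalSpace N] [ChartedSpace F N] (g : BilinField E M) (i : N → M)
    (T : ∀ p : N, Submodule ℝ (TangentSpace 𝓘(ℝ, E) (i p))) (δ : ℝ → N) (s : Set ℝ) : Prop :=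
  ContMDiffOn 𝓘(ℝ, ℝ) 𝓘(ℝ, F) ∞ δ s ∧
    ∀ t ∈ s, projAlong (immersedTangent E F i (δ t)) (T (δ t))
      (curveAcceleration g (fun r => i (δ r)) t) = 0

/-- The immersed manifold `i : N → M` is totally geodesic with respect to the transversal bundle
`T`: `TM = TN ⊕ T` along `N`, the second fundamental form vanishes, and each geodesic of the
induced connection is a geodesic of `(M, g)`. -/
structure IsTotallyGeodesic (F : Type*) [NormedAddCommGroup F] [NormedSpace ℝ F]
    {N : Type*} [TopologicalSpace N] [ChartedSpace F N] [IsManifold 𝓘(ℝ, F) ∞ N]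
    (g : BilinField E M) (i : N → M)
    (T : ∀ p : N, Submodule ℝ (TangentSpace 𝓘(ℝ, E) (i p))) : Prop where
  isCompl : ∀ p : N, IsCompl (immersedTangent E F i p) (T p)
  secondFundamentalForm_eq_zero : ∀ (U : Set N) (Y : ∀ p : N, TangentSpace 𝓘(ℝ, F) p),
    IsOpen U →
    ContMDiffOn 𝓘(ℝ, F) 𝓘(ℝ, F).tangent ∞ (fun p => (⟨p, Y p⟩ : TangentBundle 𝓘(ℝ, F) N)) U →
    ∀ p ∈ U, ∀ X : TangentSpace 𝓘(ℝ, F) p, secondFundamentalForm g i T Y p X = 0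
  geodesic : ∀ (δ : ℝ → N) (s : Set ℝ), IsOpen s → IsInducedGeodesicOn F g i T δ s →
    IsGeodesicOn g (fun r => i (δ r)) s

/-! ### Screen distributions and lightlike transversal bundles -/

/-- `W` is a smooth vector subbundle of the restriction of `TM` to `i : N → M`: it has smooth
local frames. -/
def IsSmoothSubbundle (F : Type*) [NormedAddCommGroup F] [NormedSpace ℝ F]
    {N : Type*} [TopologicalSpace N] [ChartedSpace F N] [IsManifold 𝓘(ℝ, E) ∞ M] (i : N → M)
    (W : ∀ p : N, Submodule ℝ (TangentSpace 𝓘(ℝ, E) (i p))) : Prop :=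
  ∀ p₀ : N, ∃ U : Set N, IsOpen U ∧ p₀ ∈ U ∧
    ∃ (k : ℕ) (V : Fin k → ∀ p : N, TangentSpace 𝓘(ℝ, E) (i p)),
      (∀ j, ContMDiffOn 𝓘(ℝ, F) 𝓘(ℝ, E).tangent ∞
        (fun p => (⟨i p, V j p⟩ : TangentBundle 𝓘(ℝ, E) M)) U) ∧
      ∀ p ∈ U, LinearIndependent ℝ (fun j => V j p) ∧
        Submodule.span ℝ (Set.range (fun j => V j p)) = W p

/-- `S` is a screen distribution on the lightlike hypersurface `i : N → M`: a smooth distribution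
with `TN = S ⊕ TN^⊥` (the sum is automatically orthogonal, as `S ⊆ TN`). -/
structure IsScreenDistribution (F : Type*) [NormedAddCommGroup F] [NormedSpace ℝ F]
    {N : Type*} [TopologicalSpace N] [ChartedSpace F N] [IsManifold 𝓘(ℝ, E) ∞ M]
    (g : BilinField E M) (i : N → M)
    (S : ∀ p : N, Submodule ℝ (TangentSpace 𝓘(ℝ, E) (i p))) : Prop where
  smooth : IsSmoothSubbundle F i S
  inf_eq : ∀ p, S p ⊓ immersedNormal F g i p = ⊥
  sup_eq : ∀ p, S p ⊔ immersedNormal F g i p = immersedTangent E F i p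

/-- `C` is a smooth vector subbundle of `S^⊥` with `S^⊥ = TN^⊥ ⊕ C`. -/
structure IsScreenComplement (F : Type*) [NormedAddCommGroup F] [NormedSpace ℝ F]
    {N : Type*} [TopologicalSpace N] [ChartedSpace F N] [IsManifold 𝓘(ℝ, E) ∞ M]
    (g : BilinField E M) (i : N → M)
    (S C : ∀ p : N, Submodule ℝ (TangentSpace 𝓘(ℝ, E) (i p))) : Prop where
  smooth : IsSmoothSubbundle F i C
  inf_eq : ∀ p, immersedNormal F g i p ⊓ C p = ⊥
  sup_eq : ∀ p, immersedNormal F g i p ⊔ C p = tangentOrth g (i p) (S p)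

/-- The lightlike transversal bundle built from the 1-form `θ`, its dual vector field `B` and a
complement `C` as above: its fibre at `p` is spanned by the vectors
`N_V = (1/θ(V)) (V - (g(V,V)/(2θ(V))) B)`, for `0 ≠ V ∈ C_p`. -/
def lightlikeTransversal (g : BilinField E M) (θ : OneFormField E M)
    (B : ∀ x : M, TangentSpace 𝓘(ℝ, E) x) (i : N → M)
    (C : ∀ p : N, Submodule ℝ (TangentSpace 𝓘(ℝ, E) (i p))) (p : N) :
    Submodule ℝ (TangentSpace 𝓘(ℝ, E) (i p)) :=
  Submodule.span ℝ {w | ∃ V ∈ C p, V ≠ 0 ∧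
    w = (θ (i p) V)⁻¹ • (V - (g (i p) V V / (2 * θ (i p) V)) • B (i p))}

/-! ### Leaves of a Pfaff equation -/

/-- `i : N → M` is a connected integral manifold of the distribution `θ = 0`. -/
structure IsIntegralManifold (F : Type*) [NormedAddCommGroup F] [NormedSpace ℝ F]
    {N : Type*} [TopologicalSpace N] [ChartedSpace F N] (θ : OneFormField E M) (i : N → M) :
    Prop where
  connected : ConnectedSpace N
  smooth : ContMDiff 𝓘(ℝ, F) 𝓘(ℝ, E) ∞ i
  injective : Function.Injective i
  immersion : ∀ p, Function.Injective (mfderiv 𝓘(ℝ, F) 𝓘(ℝ, E) i p)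
  tangent : ∀ p, immersedTangent E F i p = LinearMap.ker (θ (i p)).toLinearMap

universe v in
/-- `i : L → M` is a leaf of the foliation `θ = 0`: a maximal connected integral manifold. -/
structure IsLeaf (F : Type*) [NormedAddCommGroup F] [NormedSpace ℝ F]
    {L : Type v} [TopologicalSpace L] [ChartedSpace F L] (θ : OneFormField E M) (i : L → M) :
    Prop where
  integral : IsIntegralManifold F θ i
  maximal : ∀ (L' : Type v) [TopologicalSpace L'] [ChartedSpace F L'] [IsManifold 𝓘(ℝ, F) ∞ L']
    (j : L' → M), IsIntegralManifold F θ j → (Set.range i ∩ Set.range j).Nonempty →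
      Set.range j ⊆ Set.range i

end RealManifolds

section ComplexManifolds

variable {E : Type*} [NormedAddCommGroup E] [NormedSpace ℂ E]
  {M : Type*} [TopologicalSpace M] [ChartedSpace E M]

/-- A complex manifold is a smooth real manifold. -/
instance isManifold_real_of_complex [IsManifold 𝓘(ℂ, E) ω M] : IsManifold 𝓘(ℝ, E) ∞ M := by
  apply isManifold_of_contDiffOn
  intro e e' he he'
  have h := (contDiffGroupoid ω 𝓘(ℂ, E)).compatible he he'
  rw [contDiffGroupoid, mem_groupoid_of_pregroupoid] at h
  exact (ContDiffOn.restrict_scalars ℝ h.1).of_le le_top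

/-- The complex structure `J` of a complex manifold: multiplication by `√-1`. -/
def complexJ (x : M) : TangentSpace 𝓘(ℝ, E) x →L[ℝ] TangentSpace 𝓘(ℝ, E) x :=
  ((Complex.I • ContinuousLinearMap.id ℂ E).restrictScalars ℝ : E →L[ℝ] E)

/-- `g` is a `J`-invariant semi-Riemannian metric on the set `U`. -/
structure IsHermitianMetricOn [IsManifold 𝓘(ℂ, E) ω M] (g : BilinField E M) (U : Set M) :
    Prop where
  metric : IsSemiRiemannianMetricOn g U
  invariant : ∀ x ∈ U, ∀ u v : TangentSpace 𝓘(ℝ, E) x,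
    g x (complexJ x u) (complexJ x v) = g x u v

/-- `g` is a Kähler metric (of any index) on the open set `U`: Hermitian with `∇J = 0`. -/
structure IsKahlerMetricOn [IsManifold 𝓘(ℂ, E) ω M] (g : BilinField E M) (U : Set M) :
    Prop where
  hermitian : IsHermitianMetricOn g U
  parallel : ∀ x ∈ U, ∀ u v : TangentSpace 𝓘(ℝ, E) x,
    covDerivEnd g (fun y : M => complexJ y) x u v = 0

/-- `f` is a smooth function on the open set `U` such that `e^{-f} g` is Kähler on `U`. -/
structure IsKahlerPotentialOn [IsManifold 𝓘(ℂ, E) ω M] (g : BilinField E M) (U : Set M)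
    (f : M → ℝ) : Prop where
  isOpen : IsOpen U
  smooth : ContMDiffOn 𝓘(ℝ, E) 𝓘(ℝ, ℝ) ∞ f U
  kahler : IsKahlerMetricOn (fun x => Real.exp (-f x) • g x) U

/-- `(M, J, g)` is a locally conformal Kähler manifold. -/
structure IsLCK [IsManifold 𝓘(ℂ, E) ω M] (g : BilinField E M) : Prop where
  hermitian : IsHermitianMetricOn g Set.univ
  locallyConformal : ∀ x : M, ∃ (U : Set M) (f : M → ℝ), x ∈ U ∧ IsKahlerPotentialOn g U f

/-- `θ` is the Lee form of `(M, J, g)`: there is a cover of `M` by open sets `U` carrying smooth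
functions `f` with `e^{-f} g` Kähler on `U` and `θ = df` on `U`. -/
def IsLeeForm [IsManifold 𝓘(ℂ, E) ω M] (g : BilinField E M) (θ : OneFormField E M) : Prop :=
  ∀ x : M, ∃ (U : Set M) (f : M → ℝ), x ∈ U ∧ IsKahlerPotentialOn g U f ∧
    ∀ y ∈ U, ∀ v : TangentSpace 𝓘(ℝ, E) y, θ y v = (mfderiv 𝓘(ℝ, E) 𝓘(ℝ, ℝ) f y v : ℝ)

end ComplexManifolds

end

/-! Everything follows from the product rule `X(θ(V)) = (∇_X θ)(V) + θ(∇_X V)` along a map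
(`mfderiv_oneForm_apply`). When `∇θ = 0` and `V` takes values in `ker θ`, it gives `θ(∇_X V) = 0`.
Since `TL = ker θ`, covariant derivatives of fields tangent to a leaf stay tangent. Hence `h = 0`
for every transversal bundle, and the acceleration of a curve in a leaf is already tangential, so
induced geodesics are ambient geodesics (`IsParallelOneForm.isTotallyGeodesic`). What remains is
linear algebra at each point, plus the constancy of `c`.

For the constancy, the equation `∇θ = 0` paired with `B` expresses the derivative of `θ` through
that of the metric, and differentiating `g(B, ·) = θ` gives a second relation; together they force
`d(θ(B)) = 0` (`hasMFDerivAt_dual_apply_self`).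

The normal space of a leaf is `ℝB` (`immersedNormal_eq_span`). If `c ≠ 0`, then `B` is transversal
to `ker θ`; splitting off `B` orthogonally shows that the restricted metric is nondegenerate and
loses one negative direction exactly when `c < 0` (`sigNeg_eq_sigNeg_hyperplane_add`). If `c = 0`,
then `ℝB` lies in `ker θ` and is the radical. The screen complement is then a line on which `θ` is
injective, and `θ(N_V) = 1`, which makes the transversal bundle a complement
(`isCompl_immersedTangent_lightlikeTransversal`). -/

/-! ### Index of a symmetric form restricted to a hyperplane. -/

section SigNeg

variable {V W : Type*} [AddCommGroup V] [Module ℝ V] [FiniteDimensional ℝ V]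
  [AddCommGroup W] [Module ℝ W] [FiniteDimensional ℝ W]

theorem finrank_le_sigNeg {Q : QuadraticForm ℝ V} {N : Submodule ℝ V}
    (hN : ∀ v ∈ N, v ≠ 0 → Q v < 0) : Module.finrank ℝ N ≤ sigNeg Q := by
  refine le_sigNeg_of_negDef Q fun v hv => ?_
  have := hN v v.2 (by simpa using hv)
  simpa using this

theorem exists_finrank_eq_sigNeg (Q : QuadraticForm ℝ V) :
    ∃ N : Submodule ℝ V, Module.finrank ℝ N = sigNeg Q ∧ ∀ v ∈ N, v ≠ 0 → Q v < 0 := by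
  obtain ⟨N, hN, h⟩ := exists_finrank_eq_sigNeg_and_negDef Q
  refine ⟨N, hN, fun v hv hv0 => ?_⟩
  have := h ⟨v, hv⟩ (by simpa using hv0)
  simpa using this

/-- The dimension of a space on which the form pulls back to a negative definite form is at most the
index. -/
theorem finrank_le_sigNeg_of_comp_neg {U : Type*} [AddCommGroup U] [Module ℝ U]
    [FiniteDimensional ℝ U] {Q : QuadraticForm ℝ V} (f : U →ₗ[ℝ] V)
    (hf : ∀ u, u ≠ 0 → Q (f u) < 0) : Module.finrank ℝ U ≤ sigNeg Q := by
  have hinj : Function.Injective f := by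
    rw [injective_iff_map_eq_zero]
    intro u hu
    by_contra h
    simpa [hu] using hf u h
  rw [← LinearMap.finrank_range_of_inj hinj]
  refine finrank_le_sigNeg ?_
  rintro _ ⟨u, rfl⟩ hu
  exact hf u (by rintro rfl; simp at hu)

/-- The index of the restriction of a symmetric bilinear form to the orthogonal hyperplane of a
vector `b` with `g b b ≠ 0`. -/
theorem sigNeg_eq_sigNeg_hyperplane_add {g : LinearMap.BilinForm ℝ V} {ι : W →ₗ[ℝ] V} {b : V}
    (hg : ∀ u v, g u v = g v u)
    (hι : Function.Injective ι) (hrange : ∀ v, v ∈ LinearMap.range ι ↔ g v b = 0)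
    (hb : g b b ≠ 0) :
    sigNeg (LinearMap.BilinMap.toQuadraticMap g) =
      sigNeg (LinearMap.BilinMap.toQuadraticMap (g.compl₁₂ ι ι)) +
        if g b b < 0 then 1 else 0 := by
  set Q := LinearMap.BilinMap.toQuadraticMap g with hQ
  set Q' := LinearMap.BilinMap.toQuadraticMap (g.compl₁₂ ι ι) with hQ'
  have hQa : ∀ v, Q v = g v v := fun v => rfl
  have hQ'a : ∀ w, Q' w = Q (ι w) := fun w => rfl
  obtain ⟨N, hN, hNneg⟩ := exists_finrank_eq_sigNeg Q
  obtain ⟨N', hN', hN'neg⟩ := exists_finrank_eq_sigNeg Q'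
  have hιb : ∀ w, g (ι w) b = 0 := fun w => (hrange _).1 ⟨w, rfl⟩
  -- The orthogonal projection along `b`; `r` is the same map with values lifted through `ι`.
  let pr : V →ₗ[ℝ] V := LinearMap.id - ((g.flip b).smulRight ((g b b)⁻¹ • b))
  have hpr : ∀ v, pr v = v - (g v b / g b b) • b := fun v => by
    simp [pr, smul_smul, div_eq_mul_inv]
  have hprr : ∀ v, pr v ∈ LinearMap.range ι := fun v => by
    rw [hrange, hpr]; simp [hb]
  let r : V →ₗ[ℝ] W := (LinearEquiv.ofInjective ι hι).symm.toLinearMap.comp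
    (pr.codRestrict (LinearMap.range ι) hprr)
  have hr : ∀ v, ι (r v) = v - (g v b / g b b) • b := fun v => by
    rw [← hpr]
    exact congrArg Subtype.val ((LinearEquiv.ofInjective ι hι).apply_symm_apply ⟨pr v, hprr v⟩)
  have hQr : ∀ v, Q' (r v) = Q v - (g v b) ^ 2 / g b b := fun v => by
    rw [hQ'a, hr, hQa, hQa]
    simp only [map_sub, map_smul, LinearMap.sub_apply, LinearMap.smul_apply, smul_eq_mul,
      hg b v]
    field_simp
    ring
  split_ifs with hneg
  · apply le_antisymm
    -- The part of `N` orthogonal to `b` has codimension at most one, and on it `r` preserves the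
    -- form.
    · let f : N →ₗ[ℝ] ℝ := (g.flip b).comp N.subtype
      have h1 := LinearMap.finrank_range_add_finrank_ker f
      have h2 : Module.finrank ℝ (LinearMap.range f) ≤ 1 := by
        simpa using (LinearMap.range f).finrank_le
      have h3 : Module.finrank ℝ (LinearMap.ker f) ≤ sigNeg Q' := by
        refine finrank_le_sigNeg_of_comp_neg
          (r.comp (N.subtype.comp (LinearMap.ker f).subtype)) fun u hu => ?_
        have hu0 : g (u : N) b = 0 := u.2
        have : Q' (r (u : N)) < 0 := by
          rw [hQr, hu0]
          simpa using hNneg _ u.1.2 (by simpa using hu)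
        exact this
      omega
    -- Adjoining the negative vector `b` to the image of `N'`, orthogonal to it, gains one
    -- dimension.
    · have h := finrank_le_sigNeg_of_comp_neg (Q := Q)
        ((ι.comp N'.subtype).coprod (LinearMap.toSpanSingleton ℝ V b)) (by
          rintro ⟨w, t⟩ hwt
          have hval : Q (ι w + t • b) = Q' w + t ^ 2 * g b b := by
            rw [hQa, hQ'a, hQa]
            simp only [map_add, map_smul, LinearMap.add_apply, LinearMap.smul_apply, smul_eq_mul,
              hg b (ι w), hιb]
            ring
          have hgoal : Q (ι w + t • b) < 0 := by
            rw [hval]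
            by_cases hw : w = 0
            · subst hw
              have ht : t ≠ 0 := by rintro rfl; simp at hwt
              have : 0 < t ^ 2 := by positivity
              simpa using mul_neg_of_pos_of_neg this hneg
            · have h1 := hN'neg w w.2 (by simpa using hw)
              have h2 : t ^ 2 * g b b ≤ 0 := mul_nonpos_of_nonneg_of_nonpos (sq_nonneg t) hneg.le
              linarith
          simpa using hgoal)
      rw [Module.finrank_prod, Module.finrank_self, hN'] at h
      exact h
  · have hpos : 0 < g b b := lt_of_le_of_ne (not_lt.1 hneg) hb.symm
    apply le_antisymm
    · rw [← hN]
      -- For `g b b > 0` the correction term in `hQr` only lowers the value, so `r` keeps `N`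
      -- negative definite.
      refine finrank_le_sigNeg_of_comp_neg (r.comp N.subtype) fun u hu => ?_
      have h1 := hNneg u u.2 (by simpa using hu)
      have h2 : 0 ≤ (g u b) ^ 2 / g b b := by positivity
      have : Q' (r u) < 0 := by rw [hQr]; linarith
      exact this
    · rw [← hN', add_zero]
      refine finrank_le_sigNeg_of_comp_neg (ι.comp N'.subtype) fun u hu => ?_
      exact hN'neg u u.2 (by simpa using hu)

end SigNeg

/-! ### Orthogonality and complements of hyperplanes. -/

section Hyperplane

variable {V : Type*} [AddCommGroup V] [Module ℝ V] [TopologicalSpace V] [FiniteDimensional ℝ V]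
  {g : V →L[ℝ] V →L[ℝ] ℝ} {b : V}

/-- Nondegeneracy makes `V → V*` injective, hence surjective by equality of dimensions. -/
theorem exists_forall_apply_eq (hg : ∀ u, (∀ v, g u v = 0) → u = 0) (f : V →ₗ[ℝ] ℝ) :
    ∃ u, ∀ v, g u v = f v := by
  let G : V →ₗ[ℝ] Module.Dual ℝ V := (ContinuousLinearMap.coeLM ℝ).comp g.toLinearMap
  have hG : Function.Injective G := by
    rw [injective_iff_map_eq_zero]
    intro u hu
    exact hg u fun v => congrArg (fun f : Module.Dual ℝ V => f v) hu
  obtain ⟨u, hu⟩ := (LinearMap.injective_iff_surjective_of_finrank_eq_finrank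
    (Subspace.dual_finrank_eq (K := ℝ) (V := V)).symm).1 hG f
  exact ⟨u, fun v => congrArg (fun f : Module.Dual ℝ V => f v) hu⟩

omit [FiniteDimensional ℝ V] in
theorem forall_orthogonal_iff_mem_span (hg : ∀ u, (∀ v, g u v = 0) → u = 0)
    (hsymm : ∀ u v, g u v = g v u) (hb : b ≠ 0) (u : V) :
    (∀ w, g w b = 0 → g u w = 0) ↔ u ∈ Submodule.span ℝ {b} := by
  constructor
  · intro h
    obtain ⟨v, hv⟩ : ∃ v, g b v ≠ 0 := by
      by_contra! hv
      exact hb (hg b hv)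
    rw [Submodule.mem_span_singleton]
    refine ⟨g u v / g b v, ?_⟩
    rw [← sub_eq_zero]
    refine hg _ fun w => ?_
    -- The test vector is `w` corrected along `v` so as to lie in the hyperplane orthogonal to `b`.
    have hw := h (w - (g b w / g b v) • v) (by
      rw [hsymm, map_sub, map_smul, smul_eq_mul, div_mul_cancel₀ _ hv, sub_self])
    rw [map_sub, map_smul, smul_eq_mul] at hw
    rw [map_sub, map_smul, sub_apply, smul_apply, smul_eq_mul]
    linear_combination -hw
  · rintro hu w hw
    obtain ⟨a, rfl⟩ := Submodule.mem_span_singleton.1 hu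
    rw [map_smul, smul_apply, hsymm, hw, smul_zero]

omit [FiniteDimensional ℝ V] [TopologicalSpace V] in
/-- A vector on which a linear form does not vanish spans a complement of the kernel. -/
theorem isCompl_ker_span_singleton (f : V →ₗ[ℝ] ℝ) (hb : f b ≠ 0) :
    IsCompl (LinearMap.ker f) (Submodule.span ℝ {b}) := by
  constructor
  · rw [Submodule.disjoint_def]
    intro u hu hub
    obtain ⟨a, rfl⟩ := Submodule.mem_span_singleton.1 hub
    rw [LinearMap.mem_ker, map_smul, smul_eq_mul] at hu
    rw [(mul_eq_zero.1 hu).resolve_right hb, zero_smul]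
  · rw [codisjoint_iff, eq_top_iff]
    intro u _
    refine Submodule.mem_sup.2 ⟨u - (f u / f b) • b, ?_, (f u / f b) • b,
      Submodule.smul_mem _ _ (Submodule.mem_span_singleton_self b), sub_add_cancel _ _⟩
    simp [hb]

end Hyperplane

/-! ### Smoothness of tensors evaluated on fields along maps. -/

section Smoothness

variable {E : Type*} [NormedAddCommGroup E] [NormedSpace ℝ E]
  {M : Type*} [TopologicalSpace M] [ChartedSpace E M] [IsManifold 𝓘(ℝ, E) ∞ M]
  {F : Type*} [NormedAddCommGroup F] [NormedSpace ℝ F]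
  {N : Type*} [TopologicalSpace N] [ChartedSpace F N]

section

variable [IsManifold 𝓘(ℝ, F) ∞ N]

/-- The image of a smooth vector field under a smooth map is smooth as a vector field along it. -/
theorem contMDiffAt_mfderiv_apply {φ : N → M} {p : N}
    (hφ : ContMDiffAt 𝓘(ℝ, F) 𝓘(ℝ, E) ∞ φ p) {Y : ∀ q : N, TangentSpace 𝓘(ℝ, F) q}
    (hY : ContMDiffAt 𝓘(ℝ, F) 𝓘(ℝ, F).tangent ∞
      (fun q => (⟨q, Y q⟩ : TangentBundle 𝓘(ℝ, F) N)) p) :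
    ContMDiffAt 𝓘(ℝ, F) 𝓘(ℝ, E).tangent ∞
      (fun q => (⟨φ q, mfderiv 𝓘(ℝ, F) 𝓘(ℝ, E) φ q (Y q)⟩ : TangentBundle 𝓘(ℝ, E) M)) p :=
  ContMDiffAt.clm_apply_of_inCoordinates (b₁ := id) (b₂ := φ)
    (hφ.mfderiv_const (m := ∞) (by simp)) hY hφ

end

/-- The velocity of a smooth curve is a smooth vector field along it. -/
theorem contMDiffAt_curveVelocity {γ : ℝ → M} {t : ℝ} (hγ : ContMDiffAt 𝓘(ℝ, ℝ) 𝓘(ℝ, E) ∞ γ t) :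
    ContMDiffAt 𝓘(ℝ, ℝ) 𝓘(ℝ, E).tangent ∞
      (fun r => (⟨γ r, curveVelocity γ r⟩ : TangentBundle 𝓘(ℝ, E) M)) t :=
  contMDiffAt_mfderiv_apply hγ (Y := fun _ => (1 : ℝ))
    (contMDiffAt_vectorSpace_iff_contDiffAt.2 contDiffAt_const)

/-- The inverse of a chart maps constant vector fields to smooth vector fields. -/
theorem contMDiffAt_mfderiv_extChartAt_symm (x : M) {y : E}
    (hy : y ∈ (extChartAt 𝓘(ℝ, E) x).target) (u : E) :
    ContMDiffAt 𝓘(ℝ, E) 𝓘(ℝ, E).tangent ∞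
      (fun z => (⟨(extChartAt 𝓘(ℝ, E) x).symm z,
        mfderiv 𝓘(ℝ, E) 𝓘(ℝ, E) (extChartAt 𝓘(ℝ, E) x).symm z u⟩ : TangentBundle 𝓘(ℝ, E) M)) y :=
  contMDiffAt_mfderiv_apply (Y := fun _ => u)
    ((contMDiffOn_extChartAt_symm x).contMDiffAt
      ((isOpen_extChartAt_target x).mem_nhds hy))
    (contMDiffAt_vectorSpace_iff_contDiffAt.2 contDiffAt_const)

theorem IsSmoothOneForm.contMDiffAt_apply {θ : OneFormField E M} (hθ : IsSmoothOneForm θ)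
    {φ : N → M} {p : N} {V : ∀ q : N, TangentSpace 𝓘(ℝ, E) (φ q)}
    (hV : ContMDiffAt 𝓘(ℝ, F) 𝓘(ℝ, E).tangent ∞
      (fun q => (⟨φ q, V q⟩ : TangentBundle 𝓘(ℝ, E) M)) p) :
    ContMDiffAt 𝓘(ℝ, F) 𝓘(ℝ, ℝ) ∞ (fun q => (θ (φ q) (V q) : ℝ)) p := by
  have hφ : ContMDiffAt 𝓘(ℝ, F) 𝓘(ℝ, E) ∞ φ p := (contMDiffAt_totalSpace.1 hV).1
  have h : ContMDiffAt 𝓘(ℝ, F) (𝓘(ℝ, E).prod 𝓘(ℝ)) ∞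
      (fun q => TotalSpace.mk' ℝ (E := Bundle.Trivial M ℝ) (φ q) (θ (φ q) (V q))) p :=
    ContMDiffAt.clm_bundle_apply (F₁ := E) (F₂ := ℝ)
      (E₁ := fun x : M => TangentSpace 𝓘(ℝ, E) x) (E₂ := Bundle.Trivial M ℝ) (ϕ := fun q => θ (φ q)) (hθ.contMDiffAt.comp p hφ) hV
  exact (contMDiffAt_totalSpace.1 h).2

theorem IsSemiRiemannianMetricOn.contMDiffAt_apply {g : BilinField E M}
    (hg : IsSemiRiemannianMetricOn g Set.univ)
    {φ : N → M} {p : N} {V W : ∀ q : N, TangentSpace 𝓘(ℝ, E) (φ q)}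
    (hV : ContMDiffAt 𝓘(ℝ, F) 𝓘(ℝ, E).tangent ∞
      (fun q => (⟨φ q, V q⟩ : TangentBundle 𝓘(ℝ, E) M)) p)
    (hW : ContMDiffAt 𝓘(ℝ, F) 𝓘(ℝ, E).tangent ∞
      (fun q => (⟨φ q, W q⟩ : TangentBundle 𝓘(ℝ, E) M)) p) :
    ContMDiffAt 𝓘(ℝ, F) 𝓘(ℝ, ℝ) ∞ (fun q => (g (φ q) (V q) (W q) : ℝ)) p := by
  have hφ : ContMDiffAt 𝓘(ℝ, F) 𝓘(ℝ, E) ∞ φ p := (contMDiffAt_totalSpace.1 hV).1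
  have h : ContMDiffAt 𝓘(ℝ, F) (𝓘(ℝ, E).prod 𝓘(ℝ)) ∞
      (fun q => TotalSpace.mk' ℝ (E := Bundle.Trivial M ℝ) (φ q) (g (φ q) (V q) (W q))) p :=
    ContMDiffAt.clm_bundle_apply₂ (F₁ := E) (F₂ := E) (F₃ := ℝ)
      (E₁ := fun x : M => TangentSpace 𝓘(ℝ, E) x) (E₂ := fun x : M => TangentSpace 𝓘(ℝ, E) x)
      (E₃ := Bundle.Trivial M ℝ)
      (ψ := fun q => g (φ q)) ((contMDiffOn_univ.1 hg.smooth).contMDiffAt.comp p hφ) hV hW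
  exact (contMDiffAt_totalSpace.1 h).2

omit [IsManifold 𝓘(ℝ, E) ∞ M] in
/-- Smoothness of a family of linear maps on a finite-dimensional space is smoothness of its
values. -/
theorem contMDiffAt_clm_of_apply [FiniteDimensional ℝ E]
    {G : Type*} [NormedAddCommGroup G] [NormedSpace ℝ G] {f : N → E →L[ℝ] G} {p : N}
    (hf : ∀ u, ContMDiffAt 𝓘(ℝ, F) 𝓘(ℝ, G) ∞ (fun q => f q u) p) :
    ContMDiffAt 𝓘(ℝ, F) 𝓘(ℝ, E →L[ℝ] G) ∞ f p := by
  let b := Module.finBasis ℝ E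
  let c : ∀ i, E →L[ℝ] ℝ := fun i => LinearMap.toContinuousLinearMap (b.coord i)
  -- Expansion in a basis of `E`: `f` is a finite sum of fixed continuous linear maps applied to its
  -- values on basis vectors.
  have h : f = fun q => ∑ i, ContinuousLinearMap.smulRightL ℝ E G (c i) (f q (b i)) := by
    funext q
    ext u
    rw [sum_apply]
    conv_lhs => rw [← b.sum_repr u, map_sum]
    simp [c]
  rw [h]
  refine contMDiffAt_finsetSum fun i _ => ?_
  exact ((ContinuousLinearMap.smulRightL ℝ E G (c i)).contMDiff.contMDiffAt).comp p (hf (b i))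

/-- A 1-form read in a chart is smooth. -/
theorem IsSmoothOneForm.contDiffAt_formInChart [FiniteDimensional ℝ E] {θ : OneFormField E M}
    (hθ : IsSmoothOneForm θ) (x : M) {y : E} (hy : y ∈ (extChartAt 𝓘(ℝ, E) x).target) :
    ContDiffAt ℝ ∞ (formInChart θ x) y :=
  contMDiffAt_iff_contDiffAt.1 <| contMDiffAt_clm_of_apply (F := E) (N := E)
    (f := formInChart θ x) fun u =>
    hθ.contMDiffAt_apply (F := E) (N := E) (φ := (extChartAt 𝓘(ℝ, E) x).symm)
      (V := fun y => mfderiv 𝓘(ℝ, E) 𝓘(ℝ, E) (extChartAt 𝓘(ℝ, E) x).symm y u) (contMDiffAt_mfderiv_extChartAt_symm x hy u)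

/-- A metric read in a chart is smooth. -/
theorem IsSemiRiemannianMetricOn.contDiffAt_metricInChart [FiniteDimensional ℝ E]
    {g : BilinField E M} (hg : IsSemiRiemannianMetricOn g Set.univ) (x : M) {y : E}
    (hy : y ∈ (extChartAt 𝓘(ℝ, E) x).target) :
    ContDiffAt ℝ ∞ (metricInChart g x) y :=
  contMDiffAt_iff_contDiffAt.1 <| contMDiffAt_clm_of_apply (F := E) (N := E) (G := E →L[ℝ] ℝ)
    (f := metricInChart g x) fun u =>
    contMDiffAt_clm_of_apply (E := E) (F := E) (N := E) (G := ℝ)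
      (f := fun y => metricInChart g x y u) fun v =>
      hg.contMDiffAt_apply (F := E) (N := E) (φ := (extChartAt 𝓘(ℝ, E) x).symm)
        (V := fun y => mfderiv 𝓘(ℝ, E) 𝓘(ℝ, E) (extChartAt 𝓘(ℝ, E) x).symm y u)
        (W := fun y => mfderiv 𝓘(ℝ, E) 𝓘(ℝ, E) (extChartAt 𝓘(ℝ, E) x).symm y v)
        (contMDiffAt_mfderiv_extChartAt_symm x hy u)
        (contMDiffAt_mfderiv_extChartAt_symm x hy v)

/-- The pullback of a smooth metric is smooth. -/
theorem IsSemiRiemannianMetricOn.contMDiff_pullbackBilin [FiniteDimensional ℝ F]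
    [IsManifold 𝓘(ℝ, F) ∞ N]
    {g : BilinField E M} (hg : IsSemiRiemannianMetricOn g Set.univ) {i : N → M}
    (hi : ContMDiff 𝓘(ℝ, F) 𝓘(ℝ, E) ∞ i) :
    ContMDiff 𝓘(ℝ, F) (𝓘(ℝ, F).prod 𝓘(ℝ, F →L[ℝ] F →L[ℝ] ℝ)) ∞
      (fun p => (TotalSpace.mk' (F →L[ℝ] F →L[ℝ] ℝ) p (pullbackBilin (F := F) i g p) :
        TotalSpace (F →L[ℝ] F →L[ℝ] ℝ)
          (fun p : N => TangentSpace 𝓘(ℝ, F) p →L[ℝ] TangentSpace 𝓘(ℝ, F) p →L[ℝ] ℝ))) := by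
  intro p₀
  -- Constant vectors in a trivialization give smooth local fields; the pulled-back metric is tested
  -- on them.
  have hsymm : ∀ u : F, ContMDiffAt 𝓘(ℝ, F) 𝓘(ℝ, F).tangent ∞ (fun p =>
      (⟨p, (trivializationAt F (TangentSpace 𝓘(ℝ, F)) p₀).symmL ℝ p u⟩ :
        TangentBundle 𝓘(ℝ, F) N)) p₀ := fun u => by
    exact ContMDiffAt.clm_bundle_apply (F₁ := F) (F₂ := F) (b := fun p : N => p)
      (E₁ := Bundle.Trivial N F) (E₂ := fun p : N => TangentSpace 𝓘(ℝ, F) p) (v := fun _ => u)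
      ((trivializationAt F (TangentSpace 𝓘(ℝ, F)) p₀).contMDiffAt_symmL (IB := 𝓘(ℝ, F))
        (n := ∞) (mem_baseSet_trivializationAt F (TangentSpace 𝓘(ℝ, F)) p₀))
      (contMDiffAt_totalSpace.2 ⟨contMDiffAt_id, contMDiffAt_const⟩)
  refine (contMDiffAt_hom_bundle _).2 ⟨contMDiffAt_id, ?_⟩
  refine contMDiffAt_clm_of_apply (E := F) (G := F →L[ℝ] ℝ) fun u =>
    contMDiffAt_clm_of_apply (E := F) (G := ℝ) fun v => ?_
  refine (hg.contMDiffAt_apply (contMDiffAt_mfderiv_apply hi.contMDiffAt (hsymm u))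
    (contMDiffAt_mfderiv_apply hi.contMDiffAt (hsymm v))).congr_of_eventuallyEq ?_
  filter_upwards [(trivializationAt F (TangentSpace 𝓘(ℝ, F)) p₀).open_baseSet.mem_nhds
    (mem_baseSet_trivializationAt F (TangentSpace 𝓘(ℝ, F)) p₀)] with p hp
  rw [inCoordinates_apply_eq₂ hp hp (Set.mem_univ _)]
  refine (congrArg (fun f : ℝ →ₗ[ℝ] ℝ => f _)
    (Trivial.linearMapAt_trivialization (𝕜 := ℝ) (B := N) (F := ℝ) p)).trans ?_
  simp only [Trivialization.symmL_apply _ hp]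
  rfl

end Smoothness

/-! ### Chart coordinates and the product rule. -/

section Derivatives

variable {E : Type*} [NormedAddCommGroup E] [NormedSpace ℝ E]
  {M : Type*} [TopologicalSpace M] [ChartedSpace E M] [IsManifold 𝓘(ℝ, E) ∞ M]
  {F : Type*} [NormedAddCommGroup F] [NormedSpace ℝ F]
  {N : Type*} [TopologicalSpace N] [ChartedSpace F N]

theorem mfderiv_extChartAt_symm_vectorInChart (x : M) {z : E}
    (hz : z ∈ (extChartAt 𝓘(ℝ, E) x).target)
    (v : TangentSpace 𝓘(ℝ, E) ((extChartAt 𝓘(ℝ, E) x).symm z)) :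
    mfderiv 𝓘(ℝ, E) 𝓘(ℝ, E) (extChartAt 𝓘(ℝ, E) x).symm z
      (vectorInChart (E := E) x ((extChartAt 𝓘(ℝ, E) x).symm z) v) = v := by
  have : IsManifold 𝓘(ℝ, E) 1 M := IsManifold.of_le (n := ∞) (by simp)
  have h := mfderivWithin_extChartAt_symm_comp_mfderiv_extChartAt hz
  rw [ModelWithCorners.range_eq_univ, mfderivWithin_univ] at h
  exact congrArg (fun f => f v) h

theorem formInChart_vectorInChart (θ : OneFormField E M) (x : M) {y : M}
    (hy : y ∈ (extChartAt 𝓘(ℝ, E) x).source) (v : TangentSpace 𝓘(ℝ, E) y) :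
    formInChart θ x (extChartAt 𝓘(ℝ, E) x y) (vectorInChart x y v) = θ y v := by
  obtain ⟨z, hz, rfl⟩ : ∃ z ∈ (extChartAt 𝓘(ℝ, E) x).target, (extChartAt 𝓘(ℝ, E) x).symm z = y :=
    ⟨_, (extChartAt 𝓘(ℝ, E) x).map_source hy, (extChartAt 𝓘(ℝ, E) x).left_inv hy⟩
  rw [(extChartAt 𝓘(ℝ, E) x).right_inv hz]
  exact congrArg (θ _) (mfderiv_extChartAt_symm_vectorInChart x hz v)

/-- The tangent space at `x` is modelled by the preferred chart at `x`, whose differential there is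
the identity. -/
theorem vectorInChart_self (x : M) (v : TangentSpace 𝓘(ℝ, E) x) : vectorInChart x x v = v := by
  have : IsManifold 𝓘(ℝ, E) 1 M := IsManifold.of_le (n := ∞) (by simp)
  exact congrArg (fun f => f v) (mfderiv_extChartAt_self (I := 𝓘(ℝ, E)) (x := x))

theorem formInChart_self (θ : OneFormField E M) (x : M) (v : E) :
    formInChart θ x (extChartAt 𝓘(ℝ, E) x x) v = θ x v := by
  have h := formInChart_vectorInChart θ x (mem_extChartAt_source x) v
  exact (congrArg (formInChart θ x (extChartAt 𝓘(ℝ, E) x x)) (vectorInChart_self x v)).symm.trans h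

theorem metricInChart_vectorInChart (g : BilinField E M) (x : M) {y : M}
    (hy : y ∈ (extChartAt 𝓘(ℝ, E) x).source) (v w : TangentSpace 𝓘(ℝ, E) y) :
    metricInChart g x (extChartAt 𝓘(ℝ, E) x y) (vectorInChart x y v) (vectorInChart x y w) =
      g y v w := by
  obtain ⟨z, hz, rfl⟩ : ∃ z ∈ (extChartAt 𝓘(ℝ, E) x).target, (extChartAt 𝓘(ℝ, E) x).symm z = y :=
    ⟨_, (extChartAt 𝓘(ℝ, E) x).map_source hy, (extChartAt 𝓘(ℝ, E) x).left_inv hy⟩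
  rw [(extChartAt 𝓘(ℝ, E) x).right_inv hz]
  exact congrArg₂ (fun a b => g _ a b) (mfderiv_extChartAt_symm_vectorInChart x hz v)
    (mfderiv_extChartAt_symm_vectorInChart x hz w)

theorem metricInChart_self (g : BilinField E M) (x : M) (v w : E) :
    metricInChart g x (extChartAt 𝓘(ℝ, E) x x) v w = g x v w := by
  have h := metricInChart_vectorInChart g x (mem_extChartAt_source x) v w
  exact (congrArg₂ (fun a b => metricInChart g x (extChartAt 𝓘(ℝ, E) x x) a b)
    (vectorInChart_self x v) (vectorInChart_self x w)).symm.trans h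

/-- On the chart domain the differential of the chart is the preferred trivialization of the tangent
bundle, so this is the fibre component of the smooth field. -/
theorem contMDiffAt_vectorInChart {φ : N → M} {p : N} {V : ∀ q : N, TangentSpace 𝓘(ℝ, E) (φ q)}
    (hV : ContMDiffAt 𝓘(ℝ, F) 𝓘(ℝ, E).tangent ∞
      (fun q => (⟨φ q, V q⟩ : TangentBundle 𝓘(ℝ, E) M)) p) :
    ContMDiffAt 𝓘(ℝ, F) 𝓘(ℝ, E) ∞ (fun q => vectorInChart (φ p) (φ q) (V q)) p := by
  have : IsManifold 𝓘(ℝ, E) 1 M := IsManifold.of_le (n := ∞) (by simp)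
  obtain ⟨hφ, h⟩ := contMDiffAt_totalSpace.1 hV
  refine h.congr_of_eventuallyEq ?_
  filter_upwards [hφ.continuousAt.preimage_mem_nhds
    ((chartAt E (φ p)).open_source.mem_nhds (mem_chart_source E (φ p)))] with q hq
  have h1 := congrArg (fun f => f (V q))
    (TangentBundle.continuousLinearMapAt_trivializationAt (I := 𝓘(ℝ, E)) (x₀ := φ p) hq)
  refine h1.symm.trans ?_
  exact Trivialization.continuousLinearMapAt_apply_of_mem ℝ (trivializationAt E _ (φ p)) hq _

/-- The product rule `X(θ(V)) = (∇_X θ)(V) + θ(∇_X V)`. -/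
theorem mfderiv_oneForm_apply [FiniteDimensional ℝ E] (g : BilinField E M) {θ : OneFormField E M}
    (hθ : IsSmoothOneForm θ) {φ : N → M} {p : N} {V : ∀ q : N, TangentSpace 𝓘(ℝ, E) (φ q)}
    (hV : ContMDiffAt 𝓘(ℝ, F) 𝓘(ℝ, E).tangent ∞
      (fun q => (⟨φ q, V q⟩ : TangentBundle 𝓘(ℝ, E) M)) p) (X : TangentSpace 𝓘(ℝ, F) p) :
    mfderiv 𝓘(ℝ, F) 𝓘(ℝ, ℝ) (fun q => (θ (φ q) (V q) : ℝ)) p X =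
      covDerivForm g θ (φ p) (mfderiv 𝓘(ℝ, F) 𝓘(ℝ, E) φ p X) (V p) +
        θ (φ p) (covDerivAlong g φ V p X) := by
  have : IsManifold 𝓘(ℝ, E) 1 M := IsManifold.of_le (n := ∞) (by simp)
  have hφ : ContMDiffAt 𝓘(ℝ, F) 𝓘(ℝ, E) ∞ φ p := (contMDiffAt_totalSpace.1 hV).1
  set e := extChartAt 𝓘(ℝ, E) (φ p)
  have hT : HasFDerivAt (formInChart θ (φ p)) (fderiv ℝ (formInChart θ (φ p)) (e (φ p)))
      (e (φ p)) :=
    ((hθ.contDiffAt_formInChart (φ p) (mem_extChartAt_target (φ p))).differentiableAt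
      (by simp)).hasFDerivAt
  have hψ : HasMFDerivAt 𝓘(ℝ, F) 𝓘(ℝ, E) (fun q => e (φ q)) p (mfderiv 𝓘(ℝ, F) 𝓘(ℝ, E) φ p) := by
    have h1 := ((mdifferentiableAt_extChartAt (I := 𝓘(ℝ, E))
      (mem_chart_source E (φ p))).hasMFDerivAt).comp p (hφ.mdifferentiableAt (by simp)).hasMFDerivAt
    rw [mfderiv_extChartAt_self] at h1
    exact h1
  have hv := ((contMDiffAt_vectorInChart hV).mdifferentiableAt (by simp)).hasMFDerivAt
  let A : F →L[ℝ] E := mfderiv 𝓘(ℝ, F) 𝓘(ℝ, E) φ p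
  let D : F →L[ℝ] E := mfderiv 𝓘(ℝ, F) 𝓘(ℝ, E) (fun q => vectorInChart (φ p) (φ q) (V q)) p
  have hpair : HasMFDerivAt 𝓘(ℝ, F) 𝓘(ℝ, E × E)
      (fun q => (e (φ q), vectorInChart (φ p) (φ q) (V q))) p (A.prod D) :=
    ⟨hψ.1.prodMk hv.1, hψ.2.prodMk hv.2⟩
  -- In coordinates `θ(V)` is the evaluation `(y, v) ↦ T(y) v` composed with the curve of pairs in
  -- `hpair`.
  have hB : HasFDerivAt (fun z : E × E => formInChart θ (φ p) z.1 z.2) _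
      (e (φ p), vectorInChart (φ p) (φ p) (V p)) :=
    (hT.comp (e (φ p), vectorInChart (φ p) (φ p) (V p)) hasFDerivAt_fst).clm_apply hasFDerivAt_snd
  have hcomp := hB.hasMFDerivAt.comp p hpair
  have heq : (fun q => (θ (φ q) (V q) : ℝ)) =ᶠ[nhds p]
      (fun z : E × E => formInChart θ (φ p) z.1 z.2) ∘
        fun q => (e (φ q), vectorInChart (φ p) (φ q) (V q)) := by
    filter_upwards [hφ.continuousAt.preimage_mem_nhds
      (extChartAt_source_mem_nhds (I := 𝓘(ℝ, E)) (φ p))]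
      with q hq
    exact (formInChart_vectorInChart θ (φ p) hq (V q)).symm
  have hfin := congrArg (fun f : F →L[ℝ] ℝ => f X) (hcomp.congr_of_eventuallyEq heq).mfderiv
  refine hfin.trans ?_
  have h1 : formInChart θ (φ p) (e (φ p)) (D X) = θ (φ p) (D X) := formInChart_self θ (φ p) (D X)
  have h2 : vectorInChart (φ p) (φ p) (V p) = V p := vectorInChart_self (φ p) (V p)
  have h3 : θ (φ p) (covDerivAlong g φ V p X) =
      θ (φ p) (D X) + θ (φ p) (christoffel g (φ p) (A X) (V p)) := map_add (θ (φ p)) _ _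
  rw [h3, ← h1]
  change formInChart θ (φ p) (e (φ p)) (D X) +
    fderiv ℝ (formInChart θ (φ p)) (e (φ p)) (A X) (vectorInChart (φ p) (φ p) (V p)) =
    (fderiv ℝ (formInChart θ (φ p)) (e (φ p)) (A X) (V p) -
      θ (φ p) (christoffel g (φ p) (A X) (V p))) + _
  rw [h2]
  ring

end Derivatives

/-! ### Constancy of the squared length of the dual field. -/

section ParallelForm

theorem isInvertible_of_nondegenerate {V : Type*} [NormedAddCommGroup V] [NormedSpace ℝ V]
    [FiniteDimensional ℝ V] {g : V →L[ℝ] V →L[ℝ] ℝ} (hg : ∀ u, (∀ v, g u v = 0) → u = 0) :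
    g.IsInvertible := by
  have hbij : Function.Bijective g.toLinearMap := by
    constructor
    · rw [injective_iff_map_eq_zero]
      intro u hu
      exact hg u fun v => congrArg (fun f : V →L[ℝ] ℝ => f v) hu
    · intro f
      obtain ⟨u, hu⟩ := exists_forall_apply_eq hg f.toLinearMap
      exact ⟨u, ContinuousLinearMap.ext hu⟩
  exact ⟨(LinearEquiv.ofBijective g.toLinearMap hbij).toContinuousLinearEquiv, by ext; rfl⟩

variable {E : Type*} [NormedAddCommGroup E] [NormedSpace ℝ E] [FiniteDimensional ℝ E]
  {M : Type*} [TopologicalSpace M] [ChartedSpace E M]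

/-- `ContinuousLinearMap.inverse` takes the value zero on non-invertible maps; nondegeneracy in
finite dimension excludes that default. -/
theorem apply_christoffel {g : BilinField E M} {x : M}
    (hg : ∀ u : TangentSpace 𝓘(ℝ, E) x, (∀ v, g x u v = 0) → u = 0)
    (u v w : TangentSpace 𝓘(ℝ, E) x) :
    g x (christoffel g x u v) w = christoffelFirst (E := E) g x u v w :=
  congrArg (fun f : E →L[ℝ] ℝ => f w)
    ((isInvertible_of_nondegenerate (V := E) hg).self_apply_inverse
      (christoffelFirst (E := E) g x u v))

omit [FiniteDimensional ℝ E] in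
theorem christoffelFirst_apply {g : BilinField E M} {x : M}
    (hG : DifferentiableAt ℝ (metricInChart g x) (extChartAt 𝓘(ℝ, E) x x)) (u v w : E) :
    christoffelFirst g x u v w = (1 / 2 : ℝ) *
      (fderiv ℝ (metricInChart g x) (extChartAt 𝓘(ℝ, E) x x) u v w
        + fderiv ℝ (metricInChart g x) (extChartAt 𝓘(ℝ, E) x x) v u w
        - fderiv ℝ (metricInChart g x) (extChartAt 𝓘(ℝ, E) x x) w u v) := by
  have h1 : ∀ z, HasFDerivAt (fun y => metricInChart g x y z)
      ((fderiv ℝ (metricInChart g x) (extChartAt 𝓘(ℝ, E) x x)).flip z)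
      (extChartAt 𝓘(ℝ, E) x x) := fun z => by
    simpa using hG.hasFDerivAt.clm_apply (hasFDerivAt_const z (extChartAt 𝓘(ℝ, E) x x))
  have h2 := (h1 u).clm_apply (hasFDerivAt_const v (extChartAt 𝓘(ℝ, E) x x))
  unfold christoffelFirst
  dsimp only
  rw [(h1 u).fderiv, (h1 v).fderiv, h2.fderiv]
  simp

variable [IsManifold 𝓘(ℝ, E) ∞ M]

/-- The square of the length of the dual field of a parallel 1-form has vanishing derivative. -/
theorem hasMFDerivAt_dual_apply_self {g : BilinField E M}
    (hg : IsSemiRiemannianMetricOn g Set.univ) {θ : OneFormField E M}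
    (hθ : IsParallelOneForm g θ) {B : ∀ x : M, TangentSpace 𝓘(ℝ, E) x}
    (hB : ∀ x v, g x v (B x) = θ x v) (x : M) :
    HasMFDerivAt 𝓘(ℝ, E) 𝓘(ℝ, ℝ) (fun y => (g y (B y) (B y) : ℝ)) x 0 := by
  have : IsManifold 𝓘(ℝ, E) 1 M := IsManifold.of_le (n := ∞) (by simp)
  have : CompleteSpace E := FiniteDimensional.complete ℝ E
  set e := extChartAt 𝓘(ℝ, E) x with he
  set x₀ : E := e x with hx₀
  set G : E → E →L[ℝ] E →L[ℝ] ℝ := metricInChart g x with hGdef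
  set T : E → E →L[ℝ] ℝ := formInChart θ x with hTdef
  let b : E → E := fun y => vectorInChart x (e.symm y) (B (e.symm y))
  have htarget : e.target ∈ nhds x₀ := extChartAt_target_mem_nhds x
  have hG : DifferentiableAt ℝ G x₀ :=
    (hg.contDiffAt_metricInChart x (mem_extChartAt_target x)).differentiableAt (by simp)
  have hGc : ContinuousAt G x₀ :=
    (hg.contDiffAt_metricInChart x (mem_extChartAt_target x)).continuousAt
  have hT : DifferentiableAt ℝ T x₀ :=
    (hθ.1.contDiffAt_formInChart x (mem_extChartAt_target x)).differentiableAt (by simp)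
  have hGb : ∀ y ∈ e.target, ∀ u, G y u (b y) = T y u := fun y hy u => by
    have h := mfderiv_extChartAt_symm_vectorInChart x hy (B (e.symm y))
    refine (congrArg (g (e.symm y) (mfderiv 𝓘(ℝ, E) 𝓘(ℝ, E) e.symm y u)) h).trans ?_
    exact hB _ _
  have hGsymm : ∀ y u v, G y u v = G y v u := fun y u v => hg.symm _ trivial _ _
  have hGb' : ∀ y ∈ e.target, G y (b y) = T y := fun y hy => by
    ext u
    rw [hGsymm, hGb y hy]
  have hc : ∀ y ∈ e.target, (g (e.symm y) (B (e.symm y)) (B (e.symm y)) : ℝ) = T y (b y) :=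
    fun y hy => by
      rw [hB]
      exact (congrArg (θ (e.symm y))
        (mfderiv_extChartAt_symm_vectorInChart x hy (B (e.symm y)))).symm
  have hG₀ : ∀ u v : E, G x₀ u v = g x u v := metricInChart_self g x
  have hinv : (G x₀).IsInvertible := isInvertible_of_nondegenerate fun u hu =>
    hg.nondegenerate x trivial u fun v => (hG₀ u v).symm.trans (hu v)
  have hb₀ : b x₀ = B x := by
    have h : ∀ y, y = x → vectorInChart x y (B y) = B x := by
      rintro _ rfl
      exact vectorInChart_self _ _
    exact h _ (extChartAt_to_inv x)
  -- `B` carries no regularity assumption; its differentiability comes from `b = G⁻¹ T` near `x₀`,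
  -- invertibility being an open condition.
  have hbdiff : DifferentiableAt ℝ b x₀ := by
    have h1 : DifferentiableAt ℝ (fun y => (G y).inverse (T y)) x₀ :=
      ((hinv.contDiffAt_map_inverse (n := 1)).differentiableAt (by simp)).comp x₀ hG
        |>.clm_apply hT
    refine h1.congr_of_eventuallyEq ?_
    obtain ⟨A, hA⟩ := hinv
    have hA' : Set.range ((↑) : (E ≃L[ℝ] E →L[ℝ] ℝ) → E →L[ℝ] E →L[ℝ] ℝ) ∈ nhds (G x₀) := by
      rw [← hA]
      exact A.nhds
    filter_upwards [htarget, hGc.preimage_mem_nhds hA'] with y hy hy'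
    obtain ⟨A', hA'⟩ := hy'
    have hy'' : (G y).IsInvertible := ⟨A', hA'⟩
    rw [← hGb' y hy, hy''.inverse_apply_self]
  have hTb : HasFDerivAt (fun y => T y (b y)) _ x₀ := hT.hasFDerivAt.clm_apply hbdiff.hasFDerivAt
  have hGbd : HasFDerivAt (fun y => G y (b y)) _ x₀ := hG.hasFDerivAt.clm_apply hbdiff.hasFDerivAt
  have hTeq : (fun y => G y (b y)) =ᶠ[nhds x₀] T := by
    filter_upwards [htarget] with y hy using hGb' y hy
  have hfT := (hGbd.congr_of_eventuallyEq hTeq.symm).fderiv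
  -- Differentiating `G b = T` gives `∂_uT(b) = ∂_uG(b,b) + T(∂_u b)`. Parallelism gives `∂_uT(b) =
  -- ½ ∂_uG(b,b)`, as the other two Christoffel terms cancel by the repeated argument. Eliminating
  -- `∂_uG(b,b)` yields the claim.
  have hzero : ∀ u : E, fderiv ℝ T x₀ u (b x₀) + T x₀ (fderiv ℝ b x₀ u) = 0 := fun u => by
    have h1 : fderiv ℝ T x₀ u (b x₀) = fderiv ℝ G x₀ u (b x₀) (b x₀) +
        G x₀ (fderiv ℝ b x₀ u) (b x₀) := by
      rw [hfT]
      simp [add_comm]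
    have h2 : G x₀ (fderiv ℝ b x₀ u) (b x₀) = T x₀ (fderiv ℝ b x₀ u) :=
      hGb x₀ (mem_of_mem_nhds htarget) _
    have h3 : fderiv ℝ T x₀ u (b x₀) = θ x (christoffel g x u (b x₀)) :=
      sub_eq_zero.1 (hθ.2 x u (b x₀))
    have h4 : θ x (christoffel g x u (b x₀)) = christoffelFirst (E := E) g x u (b x₀) (b x₀) := by
      rw [← hB, ← hb₀]
      exact apply_christoffel (fun u hu => hg.nondegenerate x trivial u hu) _ _ _
    rw [christoffelFirst_apply hG] at h4
    have h5 : fderiv ℝ T x₀ u (b x₀) = (1 / 2 : ℝ) * (fderiv ℝ G x₀ u (b x₀) (b x₀) +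
        fderiv ℝ G x₀ (b x₀) u (b x₀) - fderiv ℝ G x₀ (b x₀) u (b x₀)) := h3.trans h4
    linarith
  have hd : HasFDerivAt (fun y => T y (b y)) (0 : E →L[ℝ] ℝ) x₀ := by
    refine hTb.congr_fderiv (ContinuousLinearMap.ext fun u => ?_)
    refine Eq.trans ?_ (hzero u)
    simp [add_comm]
  have hcomp := hd.hasMFDerivAt.comp x
    (mdifferentiableAt_extChartAt (I := 𝓘(ℝ, E)) (mem_chart_source E x)).hasMFDerivAt
  refine (hcomp.congr_mfderiv (ContinuousLinearMap.zero_comp _)).congr_of_eventuallyEq ?_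
  filter_upwards [extChartAt_source_mem_nhds (I := 𝓘(ℝ, E)) x] with y hy
  have h := hc (e y) (e.map_source hy)
  rw [e.left_inv hy] at h
  exact h

omit [FiniteDimensional ℝ E] in
/-- A function on a manifold with vanishing derivative is locally constant. -/
theorem isLocallyConstant_of_hasMFDerivAt_zero {f : M → ℝ}
    (hf : ∀ x, HasMFDerivAt 𝓘(ℝ, E) 𝓘(ℝ, ℝ) f x 0) : IsLocallyConstant f := by
  have : IsManifold 𝓘(ℝ, E) 1 M := IsManifold.of_le (n := ∞) (by simp)
  rw [IsLocallyConstant.iff_eventually_eq]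
  intro x
  set e := extChartAt 𝓘(ℝ, E) x
  obtain ⟨r, hr, hball⟩ := Metric.mem_nhds_iff.1 (extChartAt_target_mem_nhds (I := 𝓘(ℝ, E)) x)
  have hd : ∀ y ∈ e.target, HasFDerivAt (f ∘ e.symm) (0 : E →L[ℝ] ℝ) y := fun y hy => by
    have h1 : MDifferentiableAt 𝓘(ℝ, E) 𝓘(ℝ, E) e.symm y := by
      have := mdifferentiableWithinAt_extChartAt_symm (I := 𝓘(ℝ, E)) hy
      rwa [ModelWithCorners.range_eq_univ, mdifferentiableWithinAt_univ] at this
    have h2 := (hf (e.symm y)).comp y h1.hasMFDerivAt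
    rw [ContinuousLinearMap.zero_comp] at h2
    exact h2.hasFDerivAt
  have hconst : ∀ y ∈ Metric.ball (e x) r, f (e.symm y) = f (e.symm (e x)) := fun y hy =>
    Metric.isOpen_ball.is_const_of_fderiv_eq_zero (𝕜 := ℝ) (f := f ∘ e.symm)
      (convex_ball (e x) r).isPreconnected
      (fun z hz => (hd z (hball hz)).differentiableAt.differentiableWithinAt)
      (fun z hz => (hd z (hball hz)).fderiv) hy (Metric.mem_ball_self hr)
  filter_upwards [extChartAt_source_mem_nhds (I := 𝓘(ℝ, E)) x,
    (continuousAt_extChartAt (I := 𝓘(ℝ, E)) x).preimage_mem_nhds (Metric.ball_mem_nhds _ hr)]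
    with y hy hy'
  have h := hconst (e y) hy'
  rwa [e.left_inv hy, e.left_inv (mem_extChartAt_source x)] at h

end ParallelForm

/-! ### Geometry of integral manifolds of `θ = 0`. -/

section IntegralManifolds

theorem projAlong_apply_of_mem_left {V : Type*} [AddCommGroup V] [Module ℝ V]
    {P Q : Submodule ℝ V} (h : IsCompl P Q) {v : V} (hv : v ∈ P) : projAlong P Q v = v := by
  rw [projAlong, dif_pos h]
  exact Submodule.projection_apply_of_mem_left h hv

theorem projAlong_apply_of_mem_right {V : Type*} [AddCommGroup V] [Module ℝ V]
    {P Q : Submodule ℝ V} (h : IsCompl P Q) {v : V} (hv : v ∈ Q) : projAlong P Q v = 0 := by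
  rw [projAlong, dif_pos h]
  exact Submodule.projection_apply_of_mem_right h hv

variable {E : Type*} [NormedAddCommGroup E] [NormedSpace ℝ E] [FiniteDimensional ℝ E]
  {M : Type*} [TopologicalSpace M] [ChartedSpace E M] [IsManifold 𝓘(ℝ, E) ∞ M]
  {F : Type*} [NormedAddCommGroup F] [NormedSpace ℝ F]
  {N : Type*} [TopologicalSpace N] [ChartedSpace F N]

/-- The covariant derivative along a map of a vector field in the kernel of a parallel 1-form stays
in the kernel. -/
theorem IsParallelOneForm.apply_covDerivAlong_eq_zero {g : BilinField E M} {θ : OneFormField E M}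
    (hθ : IsParallelOneForm g θ) {φ : N → M} {p : N} {V : ∀ q : N, TangentSpace 𝓘(ℝ, E) (φ q)}
    (hV : ContMDiffAt 𝓘(ℝ, F) 𝓘(ℝ, E).tangent ∞
      (fun q => (⟨φ q, V q⟩ : TangentBundle 𝓘(ℝ, E) M)) p)
    (hker : ∀ᶠ q in nhds p, θ (φ q) (V q) = 0) (X : TangentSpace 𝓘(ℝ, F) p) :
    θ (φ p) (covDerivAlong g φ V p X) = 0 := by
  have h := mfderiv_oneForm_apply g hθ.1 hV X
  have h0 : mfderiv 𝓘(ℝ, F) 𝓘(ℝ, ℝ) (fun q => (θ (φ q) (V q) : ℝ)) p =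
      mfderiv 𝓘(ℝ, F) 𝓘(ℝ, ℝ) (fun _ => (0 : ℝ)) p := Filter.EventuallyEq.mfderiv_eq hker
  have h0X := congrArg (fun f : F →L[ℝ] ℝ => f X) (h0.trans mfderiv_const)
  rw [hθ.2, zero_add] at h
  exact h.symm.trans h0X

variable [IsManifold 𝓘(ℝ, F) ∞ N]

/-- An integral manifold of the kernel of a parallel 1-form is totally geodesic with respect to
every transversal bundle. -/
theorem IsParallelOneForm.isTotallyGeodesic {g : BilinField E M} {θ : OneFormField E M}
    (hθ : IsParallelOneForm g θ) {i : N → M} (hi : ContMDiff 𝓘(ℝ, F) 𝓘(ℝ, E) ∞ i)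
    (htan : ∀ p, immersedTangent E F i p = LinearMap.ker (θ (i p)).toLinearMap)
    {T : ∀ p : N, Submodule ℝ (TangentSpace 𝓘(ℝ, E) (i p))}
    (hT : ∀ p, IsCompl (immersedTangent E F i p) (T p)) : IsTotallyGeodesic F g i T where
  isCompl := hT
  secondFundamentalForm_eq_zero U Y hU hY p hp X := by
    -- The transversal part vanishes because the covariant derivative lies in `ker θ = TN`.
    refine projAlong_apply_of_mem_right (hT p).symm ?_
    rw [htan]
    refine hθ.apply_covDerivAlong_eq_zero (contMDiffAt_mfderiv_apply hi.contMDiffAt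
      (hY.contMDiffAt (hU.mem_nhds hp))) (Filter.Eventually.of_forall fun q => ?_) X
    have : mfderiv 𝓘(ℝ, F) 𝓘(ℝ, E) i q (Y q) ∈ immersedTangent E F i q := ⟨Y q, rfl⟩
    rwa [htan] at this
  geodesic δ s hs hδ := by
    have hγ : ∀ t ∈ s, ContMDiffAt 𝓘(ℝ, ℝ) 𝓘(ℝ, E) ∞ (fun r => i (δ r)) t := fun t ht =>
      hi.contMDiffAt.comp t (hδ.1.contMDiffAt (hs.mem_nhds ht))
    refine ⟨fun t ht => (hγ t ht).contMDiffWithinAt, fun t ht => ?_⟩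
    -- The acceleration is tangential, so the tangential projection, zero by hypothesis, is the
    -- acceleration itself.
    refine (projAlong_apply_of_mem_left (hT (δ t)) ?_).symm.trans (hδ.2 t ht)
    rw [htan]
    refine hθ.apply_covDerivAlong_eq_zero (φ := fun r => i (δ r))
      (contMDiffAt_curveVelocity (hγ t ht)) ?_ _
    filter_upwards [hs.mem_nhds ht] with r hr
    have hmem : curveVelocity (E := E) (fun r => i (δ r)) r ∈ immersedTangent E F i (δ r) := by
      refine ⟨mfderiv 𝓘(ℝ, ℝ) 𝓘(ℝ, F) δ r (1 : ℝ), ?_⟩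
      exact congrArg (fun f : ℝ →L[ℝ] E => f 1) (mfderiv_comp r
        (hi.mdifferentiableAt (by simp))
        ((hδ.1.contMDiffAt (hs.mem_nhds hr)).mdifferentiableAt (by simp))).symm
    rw [htan] at hmem
    exact hmem

omit [FiniteDimensional ℝ E] [IsManifold 𝓘(ℝ, F) ∞ N] in
/-- The normal space of an integral manifold of `θ = 0` is spanned by the dual field of `θ`. -/
theorem immersedNormal_eq_span {g : BilinField E M} (hg : IsSemiRiemannianMetricOn g Set.univ)
    {θ : OneFormField E M} {B : ∀ x : M, TangentSpace 𝓘(ℝ, E) x}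
    (hB : ∀ x v, g x v (B x) = θ x v) {i : N → M} {p : N} (hB0 : B (i p) ≠ 0)
    (htan : immersedTangent E F i p = LinearMap.ker (θ (i p)).toLinearMap) :
    immersedNormal F g i p = Submodule.span ℝ {B (i p)} := by
  ext u
  rw [← forall_orthogonal_iff_mem_span (hg.nondegenerate (i p) trivial) (hg.symm (i p) trivial) hB0]
  change (∀ w ∈ immersedTangent E F i p, g (i p) u w = 0) ↔ _
  rw [htan]
  simp only [hB]
  rfl

variable [FiniteDimensional ℝ F]

/-- An integral manifold of `θ = 0` is a semi-Riemannian hypersurface where the dual field of `θ`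
is not lightlike. -/
theorem isSemiRiemannianHypersurface_of_ne_zero {g : BilinField E M}
    (hg : IsSemiRiemannianMetricOn g Set.univ) {θ : OneFormField E M}
    {B : ∀ x : M, TangentSpace 𝓘(ℝ, E) x} (hB : ∀ x v, g x v (B x) = θ x v)
    {i : N → M} (hi : IsImmersedHypersurface E F i)
    (htan : ∀ p, immersedTangent E F i p = LinearMap.ker (θ (i p)).toLinearMap)
    {c : ℝ} (hc : ∀ p, g (i p) (B (i p)) (B (i p)) = c) (hc0 : c ≠ 0)
    {ν : ℕ} (hν : ∀ p, tangentIndex g (i p) = ν) :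
    IsSemiRiemannianHypersurface F g i (if 0 < c then ν else ν - 1) where
  hypersurface := hi
  metric :=
    { smooth := (hg.contMDiff_pullbackBilin hi.smooth).contMDiffOn
      symm := fun p _ u v => hg.symm (i p) trivial _ _
      nondegenerate := fun p _ u hu => by
        have hB0 : B (i p) ≠ 0 := fun h => hc0 (by rw [← hc p, h, map_zero])
        have h1 : mfderiv 𝓘(ℝ, F) 𝓘(ℝ, E) i p u ∈ immersedNormal F g i p := by
          rintro _ ⟨v, rfl⟩
          exact hu v
        have h2 : mfderiv 𝓘(ℝ, F) 𝓘(ℝ, E) i p u ∈ immersedTangent E F i p := ⟨u, rfl⟩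
        rw [immersedNormal_eq_span hg hB hB0 (htan p)] at h1
        rw [htan] at h2
        -- A degenerate direction maps into `ker θ ∩ ℝB`, which is zero since `θ(B) = c ≠ 0`.
        have h3 := (isCompl_ker_span_singleton (θ (i p)).toLinearMap
          (b := B (i p)) (by
            change θ (i p) (B (i p)) ≠ 0
            rwa [← hB, hc])).disjoint.le_bot ⟨h2, h1⟩
        exact hi.immersion p (((Submodule.mem_bot ℝ).1 h3).trans (map_zero _).symm) }
  index p := by
    have : FiniteDimensional ℝ (TangentSpace 𝓘(ℝ, E) (i p)) := inferInstanceAs (FiniteDimensional ℝ E)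
    have : FiniteDimensional ℝ (TangentSpace 𝓘(ℝ, F) p) := inferInstanceAs (FiniteDimensional ℝ F)
    have h := sigNeg_eq_sigNeg_hyperplane_add
      (g := ((ContinuousLinearMap.coeLM ℝ).comp (g (i p)).toLinearMap :
        LinearMap.BilinForm ℝ (TangentSpace 𝓘(ℝ, E) (i p))))
      (ι := (mfderiv 𝓘(ℝ, F) 𝓘(ℝ, E) i p).toLinearMap) (b := B (i p))
      (hg.symm (i p) trivial) (hi.immersion p)
      (fun v => by
        change v ∈ immersedTangent E F i p ↔ g (i p) v (B (i p)) = 0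
        rw [htan, hB]
        rfl)
      ((hc p).trans_ne hc0)
    have h' : ν = tangentIndex (pullbackBilin (F := F) i g) p +
        if g (i p) (B (i p)) (B (i p)) < 0 then 1 else 0 := (hν p).symm.trans h
    rw [hc p] at h'
    split_ifs with hpos
    · rw [if_neg (not_lt.2 hpos.le)] at h'
      exact h'.symm
    -- Here `h'` exhibits `ν` as a successor, so the truncated subtraction is exact.
    · rw [if_pos (lt_of_le_of_ne (not_lt.1 hpos) hc0)] at h'
      omega

omit [FiniteDimensional ℝ E] [IsManifold 𝓘(ℝ, F) ∞ N] [FiniteDimensional ℝ F] in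
/-- An integral manifold of `θ = 0` is a lightlike hypersurface where the dual field of `θ` is
lightlike. -/
theorem isLightlikeHypersurface_of_eq_zero {g : BilinField E M}
    (hg : IsSemiRiemannianMetricOn g Set.univ) {θ : OneFormField E M}
    {B : ∀ x : M, TangentSpace 𝓘(ℝ, E) x} (hB : ∀ x v, g x v (B x) = θ x v)
    (hB0 : ∀ x, B x ≠ 0) {i : N → M} (hi : IsImmersedHypersurface E F i)
    (htan : ∀ p, immersedTangent E F i p = LinearMap.ker (θ (i p)).toLinearMap)
    (hc : ∀ p, g (i p) (B (i p)) (B (i p)) = 0) : IsLightlikeHypersurface F g i where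
  hypersurface := hi
  radical p := by
    rw [immersedNormal_eq_span hg hB (hB0 _) (htan p), htan, inf_eq_right.2]
    · exact finrank_span_singleton (hB0 (i p))
    · rw [Submodule.span_singleton_le_iff_mem, LinearMap.mem_ker]
      exact (hB _ _).symm.trans (hc p)

omit [IsManifold 𝓘(ℝ, F) ∞ N] [FiniteDimensional ℝ F] in
/-- The lightlike transversal bundle is complementary to the tangent bundle. -/
theorem isCompl_immersedTangent_lightlikeTransversal {g : BilinField E M}
    (hg : IsSemiRiemannianMetricOn g Set.univ) {θ : OneFormField E M}
    {B : ∀ x : M, TangentSpace 𝓘(ℝ, E) x} (hB : ∀ x v, g x v (B x) = θ x v)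
    (hB0 : ∀ x, B x ≠ 0) {i : N → M}
    (htan : ∀ p, immersedTangent E F i p = LinearMap.ker (θ (i p)).toLinearMap)
    (hc : ∀ p, g (i p) (B (i p)) (B (i p)) = 0)
    {S C : ∀ p : N, Submodule ℝ (TangentSpace 𝓘(ℝ, E) (i p))}
    (hS : IsScreenDistribution F g i S) (hC : IsScreenComplement F g i S C) (p : N) :
    IsCompl (immersedTangent E F i p) (lightlikeTransversal g θ B i C p) := by
  have : FiniteDimensional ℝ (TangentSpace 𝓘(ℝ, E) (i p)) := inferInstanceAs (FiniteDimensional ℝ E)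
  have hN := immersedNormal_eq_span hg hB (hB0 (i p)) (htan p)
  have hθB : θ (i p) (B (i p)) = 0 := (hB _ _).symm.trans (hc p)
  have hSinf := hS.inf_eq p
  have hSsup := hS.sup_eq p
  have hCinf := hC.inf_eq p
  have hCsup := hC.sup_eq p
  rw [hN] at hSinf hSsup hCinf hCsup
  rw [htan] at hSsup ⊢
  -- a vector of `C` tangent to the hypersurface vanishes
  have hCker : ∀ V ∈ C p, θ (i p) V = 0 → V = 0 := fun V hV hθV => by
    have hVS : V ∈ tangentOrth g (i p) (S p) := hCsup ▸ Submodule.mem_sup_right hV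
    -- `V` is orthogonal to `S`, and to `B` because `θ(V) = 0`; hence to `S + ℝB = ker θ`, whose
    -- orthogonal space is `ℝB`.
    have hVN : V ∈ Submodule.span ℝ {B (i p)} := by
      rw [← forall_orthogonal_iff_mem_span (hg.nondegenerate (i p) trivial)
        (hg.symm (i p) trivial) (hB0 _)]
      intro w hw
      have hw' : w ∈ S p ⊔ Submodule.span ℝ {B (i p)} := by
        rw [hSsup]
        exact (hB _ _).symm.trans hw
      obtain ⟨a, ha, b, hb, rfl⟩ := Submodule.mem_sup.1 hw'
      obtain ⟨t, rfl⟩ := Submodule.mem_span_singleton.1 hb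
      rw [map_add, map_smul, hVS a ha, hB, hθV, smul_zero, add_zero]
    exact (Submodule.mem_bot ℝ).1 (hCinf ▸ ⟨hVN, hV⟩)
  -- As `B ∉ S`, some functional kills `S` but not `B`. Its dual vector lies in `S^⊥ = ℝB + C`, and
  -- its `C`-component carries the nonzero value of `θ`, since `θ(B) = 0`.
  obtain ⟨V, hV, hθV⟩ : ∃ V ∈ C p, θ (i p) V ≠ 0 := by
    have hBS : B (i p) ∉ S p := fun h => hB0 (i p) <| (Submodule.mem_bot ℝ).1
      (hSinf ▸ ⟨h, Submodule.mem_span_singleton_self _⟩)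
    obtain ⟨f, hfB, hfS⟩ := Submodule.exists_le_ker_of_notMem hBS
    obtain ⟨u, hu⟩ := exists_forall_apply_eq (hg.nondegenerate (i p) trivial) f
    have huS : u ∈ tangentOrth g (i p) (S p) := fun w hw => (hu w).trans (hfS hw)
    rw [← hCsup] at huS
    obtain ⟨a, ha, V, hV, rfl⟩ := Submodule.mem_sup.1 huS
    obtain ⟨t, rfl⟩ := Submodule.mem_span_singleton.1 ha
    refine ⟨V, hV, fun h => hfB ?_⟩
    rw [← hu, hB, map_add, map_smul, hθB, h, smul_zero, add_zero]
  set n := (θ (i p) V)⁻¹ • (V - (g (i p) V V / (2 * θ (i p) V)) • B (i p)) with hn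
  -- `θ` is injective on `C`, so `C` is the line through `V`; and `N_V` is unchanged when `V` is
  -- rescaled. All generators coincide.
  have hspan : lightlikeTransversal g θ B i C p = Submodule.span ℝ {n} := by
    refine congrArg (Submodule.span ℝ) (Set.ext fun w => ⟨?_, ?_⟩)
    · rintro ⟨W, hW, hW0, rfl⟩
      have hθW : θ (i p) W ≠ 0 := fun h => hW0 (hCker W hW h)
      have hprop : W = (θ (i p) W / θ (i p) V) • V := by
        rw [← sub_eq_zero]
        refine hCker _ (Submodule.sub_mem _ hW (Submodule.smul_mem _ _ hV)) ?_
        rw [map_sub, map_smul, smul_eq_mul, div_mul_cancel₀ _ hθV, sub_self]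
      set a := θ (i p) W / θ (i p) V with ha
      have ha0 : a ≠ 0 := div_ne_zero hθW hθV
      rw [Set.mem_singleton_iff, hn, hprop]
      simp only [map_smul, smul_apply, smul_eq_mul, smul_sub, smul_smul]
      congr 2 <;> field_simp
    · rintro rfl
      exact ⟨V, hV, fun h => hθV (by rw [h, map_zero]), rfl⟩
  rw [hspan]
  refine isCompl_ker_span_singleton _ ?_
  change θ (i p) n ≠ 0
  rw [hn, map_smul, map_sub, map_smul, hθB, smul_zero, sub_zero, smul_eq_mul, inv_mul_cancel₀ hθV]
  exact one_ne_zero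

end IntegralManifolds

/-! ### The main theorem. -/

theorem theorem1 {E : Type*} [NormedAddCommGroup E] [NormedSpace ℂ E] [FiniteDimensional ℂ E]
    {M : Type*} [TopologicalSpace M] [ChartedSpace E M] [IsManifold 𝓘(ℂ, E) ω M]
    (n s : ℕ) (hn : Module.finrank ℂ E = n) (hs : 0 < s) (hsn : s < n)
    (g : BilinField E M) (hg : IsLCK g) (hindex : ∀ x, tangentIndex g x = 2 * s)
    (θ : OneFormField E M) (hθ : IsLeeForm g θ) (hparallel : IsParallelOneForm g θ)
    (B : ∀ x : M, TangentSpace 𝓘(ℝ, E) x) (hB : ∀ x v, g x v (B x) = θ x v)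
    (hsing : ∀ x, B x ≠ 0) :
    IsLocallyConstant (fun x => g x (B x) (B x)) ∧
    ∀ (L : Type*) [TopologicalSpace L] [ChartedSpace (EuclideanSpace ℝ (Fin (2 * n - 1))) L]
      [IsManifold 𝓘(ℝ, EuclideanSpace ℝ (Fin (2 * n - 1))) ∞ L] (i : L → M),
      IsLeaf (EuclideanSpace ℝ (Fin (2 * n - 1))) θ i →
      ∃ c : ℝ, (∀ p, g (i p) (B (i p)) (B (i p)) = c) ∧
        (c ≠ 0 →
          IsSemiRiemannianHypersurface (EuclideanSpace ℝ (Fin (2 * n - 1))) g i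
            (if 0 < c then 2 * s else 2 * s - 1) ∧
          IsTotallyGeodesic (EuclideanSpace ℝ (Fin (2 * n - 1))) g i
            (immersedNormal (EuclideanSpace ℝ (Fin (2 * n - 1))) g i)) ∧
        (c = 0 →
          IsLightlikeHypersurface (EuclideanSpace ℝ (Fin (2 * n - 1))) g i ∧
          ∀ S C : ∀ p : L, Submodule ℝ (TangentSpace 𝓘(ℝ, E) (i p)),
            IsScreenDistribution (EuclideanSpace ℝ (Fin (2 * n - 1))) g i S →
            IsScreenComplement (EuclideanSpace ℝ (Fin (2 * n - 1))) g i S C →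
            IsTotallyGeodesic (EuclideanSpace ℝ (Fin (2 * n - 1))) g i
              (lightlikeTransversal g θ B i C)) := by
  have hE : FiniteDimensional ℝ E := FiniteDimensional.complexToReal E
  have hgm : IsSemiRiemannianMetricOn g Set.univ := hg.hermitian.metric
  have hconst : IsLocallyConstant (fun x => g x (B x) (B x)) :=
    isLocallyConstant_of_hasMFDerivAt_zero (hasMFDerivAt_dual_apply_self hgm hparallel hB)
  refine ⟨hconst, fun L _ _ _ i hi => ?_⟩
  have hint := hi.integral
  have : ConnectedSpace L := hint.connected
  -- The codimension count `2n = (2n - 1) + 1` needs `n > 0`, which follows from `0 < s < n`.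
  have hhyp : IsImmersedHypersurface E (EuclideanSpace ℝ (Fin (2 * n - 1))) i :=
    ⟨hint.smooth, hint.injective, hint.immersion, by
      rw [finrank_real_of_complex, hn, finrank_euclideanSpace_fin]
      omega⟩
  obtain ⟨p₀⟩ : Nonempty L := inferInstance
  have hc : ∀ p, g (i p) (B (i p)) (B (i p)) = g (i p₀) (B (i p₀)) (B (i p₀)) := fun p =>
    (hconst.comp_continuous hint.smooth.continuous).apply_eq_of_preconnectedSpace p p₀
  refine ⟨_, hc, fun hc0 => ⟨?_, ?_⟩, fun hc0 => ⟨?_, fun S C hS hC => ?_⟩⟩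
  · exact isSemiRiemannianHypersurface_of_ne_zero hgm hB hhyp hint.tangent hc hc0
      fun p => hindex (i p)
  · refine hparallel.isTotallyGeodesic hint.smooth hint.tangent fun p => ?_
    rw [immersedNormal_eq_span hgm hB (hsing (i p)) (hint.tangent p), hint.tangent p]
    refine isCompl_ker_span_singleton _ ?_
    change θ (i p) (B (i p)) ≠ 0
    rwa [← hB, hc]
  · exact isLightlikeHypersurface_of_eq_zero hgm hB hsing hhyp hint.tangent
      fun p => (hc p).trans hc0
  · exact hparallel.isTotallyGeodesic hint.smooth hint.tangent
      (isCompl_immersedTangent_lightlikeTransversal hgm hB hsing hint.tangent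
        (fun p => (hc p).trans hc0) hS hC)
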